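/- Let $N\subset M$ be a unital inclusion of finite factors, realised as von Neumann algebras on a common Hilbert space, for example with $[M:N]<\infty$ (finiteness of the index is not needed below). Let $\tau$ be the faithful normal tracial state of $M$, and let $E:M\to N$ be the $\tau$-preserving conditional expectation. **The quantum Galois groups.** A Hopf $*$-algebra is a complex Hopf algebra $Q$ with a $*$-algebra structure such that $\Delta$ is a $*$-homomorphism and $S(S(h)^*)^*=h$ for all $h\in Q$. Let $\mathrm C(N\subset M)$ be the category whose objects are Hopf $*$-algebras $Q$ together with a module $*$-algebra structure on $M$, that is, a left $Q$-module structure on $M$ with $$h\cdot(xy)=(h_1\cdot x)(h_2\cdot y),\qquad h\cdot 1=\varepsilon(h)1,\qquad (h\cdot x)^*=S(h)^*\cdot x^*,$$ such that $h\cdot n=\varepsilon(h)n$ for all $n\in N$; its morphisms are the Hopf $*$-algebra morphisms that intertwine the actions. Let $\mathrm C_\tau(N\subset M)$ be the full subcategory of the objects with $\tau(h\cdot x)=\varepsilon(h)\tau(x)$ for all $h$ and $x$. The quantum Galois groups $\mathrm{QGal}(N\subset M)$ and $\mathrm{QGal}_\tau(N\subset M)$ are the terminal objects of $\mathrm C(N\subset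 M)$ and $\mathrm C_\tau(N\subset M)$. **The quantum automorphism groups.** Let $\mathrm{Bimod}_{N-N}$ be the monoidal category of (algebraic) $N$-$N$-bimodules over $\mathbb C$ with tensor product $\otimes_N$ and unit object $N$. In it $M$ is an algebra object, with multiplication $\mu:M\otimes_N M\to M$ and unit $\eta:N\to M$. A Hopf action of $Q$ on the algebra object $M$ (in the sense of Bischoff--Davydov) is an algebra homomorphism $\rho:Q\to\mathrm{End}({}_NM_N)$ such that, for all $h\in Q$, $$\rho(h)\circ\mu=\mu\circ(\rho(h_1)\otimes_N\rho(h_2)),\qquad \rho(h)\circ\eta=\varepsilon(h)\,\eta .$$ For a Hopf $*$-algebra $Q$ it is also required that $\rho(S(h)^*)$ is the conjugate $x\mapsto(\rho(h)(x^*))^*$ of $\rho(h)$. The quantum automorphism group of the algebra object $M$ is the terminal object of the category of Hopf $*$-algebras with such an action on $M$ and Hopf $*$-algebra morphisms intertwining the actions. Its $E$-preserving version is the terminal object of the full subcategory of the actions with $E\circ\rho(h)=\varepsilon(h)E$ for all $h$. **Theorem.** All four terminal objects exist. $\mathrm{QGal}(N\subset M)$ is isomorphic to the quantum automorphism group of the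 algebra object $M$ in $\mathrm{Bimod}_{N-N}$, and $\mathrm{QGal}_\tau(N\subset M)$ is isomorphic to its $E$-preserving version. In both cases there is an isomorphism of Hopf $*$-algebras that intertwines the actions on $M$. -/

import Mathlib

open CategoryTheory MonoidalCategory
open scoped TensorProduct ComplexOrder

universe u

noncomputable section

/-! ### The monoidal category of bimodules over a complex algebra -/

/-- A bimodule over a complex algebra `N`: a complex vector space with commuting
left and right actions of `N`. -/
structure NBimod (N : Type u) [Ring N] [Algebra ℂ N] where
  carrier : Type u
  [addCommGroup : AddCommGroup carrier]
  [module : Module ℂ carrier]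
  /-- `left a x` is `a · x` -/
  left : N →ₐ[ℂ] Module.End ℂ carrier
  /-- `right (op a) x` is `x · a` -/
  right : Nᵐᵒᵖ →ₐ[ℂ] Module.End ℂ carrier
  left_right : ∀ (a : N) (b : Nᵐᵒᵖ) (x : carrier), left a (right b x) = right b (left a x)

attribute [instance] NBimod.addCommGroup NBimod.module

namespace NBimod

variable {N : Type u} [Ring N] [Algebra ℂ N]

instance : CoeSort (NBimod N) (Type u) := ⟨NBimod.carrier⟩

/-- Bimodule maps. -/
@[ext]
structure Hom (X Y : NBimod N) where
  lin : X →ₗ[ℂ] Y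
  map_left : ∀ (a : N) (x : X), lin (X.left a x) = Y.left a (lin x)
  map_right : ∀ (a : Nᵐᵒᵖ) (x : X), lin (X.right a x) = Y.right a (lin x)

instance : Category (NBimod N) where
  Hom X Y := Hom X Y
  id X := ⟨LinearMap.id, fun _ _ => rfl, fun _ _ => rfl⟩
  comp f g := ⟨g.lin ∘ₗ f.lin, fun a x => by simp [f.map_left, g.map_left],
    fun a x => by simp [f.map_right, g.map_right]⟩

/-- The linear map underlying a morphism of bimodules. -/
def lin {X Y : NBimod N} (f : X ⟶ Y) : X →ₗ[ℂ] Y := Hom.lin f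

/-- Constructor for morphisms of bimodules. -/
def ofLin {X Y : NBimod N} (f : X →ₗ[ℂ] Y)
    (hl : ∀ (a : N) (x : X), f (X.left a x) = Y.left a (f x))
    (hr : ∀ (a : Nᵐᵒᵖ) (x : X), f (X.right a x) = Y.right a (f x)) : X ⟶ Y :=
  Hom.mk f hl hr

@[ext]
theorem hom_ext {X Y : NBimod N} {f g : X ⟶ Y} (h : lin f = lin g) : f = g := Hom.ext h

theorem lin_left {X Y : NBimod N} (f : X ⟶ Y) (a : N) (x : X) :
    lin f (X.left a x) = Y.left a (lin f x) := Hom.map_left f a x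

theorem lin_right {X Y : NBimod N} (f : X ⟶ Y) (a : Nᵐᵒᵖ) (x : X) :
    lin f (X.right a x) = Y.right a (lin f x) := Hom.map_right f a x

@[simp] theorem lin_ofLin {X Y : NBimod N} (f : X →ₗ[ℂ] Y) (hl) (hr) :
    lin (ofLin (X := X) (Y := Y) f hl hr) = f := rfl

@[simp] theorem lin_id (X : NBimod N) : lin (𝟙 X) = LinearMap.id := rfl

@[simp] theorem lin_comp {X Y Z : NBimod N} (f : X ⟶ Y) (g : Y ⟶ Z) :
    lin (f ≫ g) = lin g ∘ₗ lin f := rfl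

/-! The hom spaces are complex vector spaces, with pointwise operations. -/

section Linear

variable {X Y : NBimod N}

instance : Add (X ⟶ Y) := ⟨fun f g => ofLin (lin f + lin g)
  (fun a x => by simp [lin_left]) (fun a x => by simp [lin_right])⟩

instance : Zero (X ⟶ Y) := ⟨ofLin 0 (fun a x => by simp) (fun a x => by simp)⟩

instance : Neg (X ⟶ Y) := ⟨fun f => ofLin (-lin f)
  (fun a x => by simp [lin_left]) (fun a x => by simp [lin_right])⟩

instance : SMul ℂ (X ⟶ Y) := ⟨fun c f => ofLin (c • lin f)
  (fun a x => by simp [lin_left]) (fun a x => by simp [lin_right])⟩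

@[simp] theorem lin_add (f g : X ⟶ Y) : lin (f + g) = lin f + lin g := rfl
@[simp] theorem lin_zero : lin (0 : X ⟶ Y) = 0 := rfl
@[simp] theorem lin_neg (f : X ⟶ Y) : lin (-f) = -lin f := rfl
@[simp] theorem lin_smul (c : ℂ) (f : X ⟶ Y) : lin (c • f) = c • lin f := rfl

instance : AddCommGroup (X ⟶ Y) where
  add_assoc f g h := by ext1; simp [add_assoc]
  zero_add f := by ext1; simp
  add_zero f := by ext1; simp
  add_comm f g := by ext1; simp [add_comm]
  neg_add_cancel f := by ext1; simp
  nsmul := nsmulRec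
  zsmul := zsmulRec

instance : Module ℂ (X ⟶ Y) where
  one_smul f := by ext1; simp
  mul_smul a b f := by ext1; simp [mul_smul]
  smul_zero a := by ext1; simp
  smul_add a f g := by ext1; simp
  add_smul a b f := by ext1; simp [add_smul]
  zero_smul f := by ext1; simp

end Linear

instance : Preadditive (NBimod N) where
  add_comp _ _ _ f g h := by ext1; simp [LinearMap.comp_add]
  comp_add _ _ _ f g h := by ext1; simp [LinearMap.add_comp]

instance : Linear ℂ (NBimod N) where
  smul_comp _ _ _ c f g := by ext1; simp [LinearMap.comp_smul]
  comp_smul _ _ _ f c g := by ext1; simp [LinearMap.smul_comp]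

/-! The tensor product `X ⊗_N Y`: the quotient of `X ⊗ Y` by the relations
`x · a ⊗ y = x ⊗ a · y`. -/

/-- The span of the elements `x · a ⊗ y - x ⊗ a · y`. -/
def balanced (X Y : NBimod N) : Submodule ℂ (X ⊗[ℂ] Y) :=
  Submodule.span ℂ (Set.range fun t : X × N × Y =>
    X.right (.op t.2.1) t.1 ⊗ₜ[ℂ] t.2.2 - t.1 ⊗ₜ[ℂ] Y.left t.2.1 t.2.2)

/-- The vector space `X ⊗_N Y`. -/
abbrev Tens (X Y : NBimod N) : Type u := (X ⊗[ℂ] Y) ⧸ balanced X Y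

/-- The canonical bilinear map `(x, y) ↦ x ⊗ y`. -/
def tmk (X Y : NBimod N) : X →ₗ[ℂ] Y →ₗ[ℂ] Tens X Y :=
  (TensorProduct.mk ℂ X Y).compr₂ (balanced X Y).mkQ

theorem tmk_balanced {X Y : NBimod N} (x : X) (a : N) (y : Y) :
    tmk X Y (X.right (.op a) x) y = tmk X Y x (Y.left a y) := by
  refine (Submodule.Quotient.eq _).2 (Submodule.subset_span ⟨(x, a, y), rfl⟩)

/-- The linear map on `X ⊗_N Y` induced by a balanced bilinear map. -/
def tlift {X Y : NBimod N} {W : Type u} [AddCommGroup W] [Module ℂ W] (f : X →ₗ[ℂ] Y →ₗ[ℂ] W)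
    (hf : ∀ x a y, f (X.right (.op a) x) y = f x (Y.left a y)) : Tens X Y →ₗ[ℂ] W :=
  (balanced X Y).liftQ (TensorProduct.lift f) <| by
    rw [balanced, Submodule.span_le]
    rintro _ ⟨⟨x, a, y⟩, rfl⟩
    simp [hf]

@[simp] theorem tlift_tmk {X Y : NBimod N} {W : Type u} [AddCommGroup W] [Module ℂ W]
    (f : X →ₗ[ℂ] Y →ₗ[ℂ] W) (hf) (x : X) (y : Y) : tlift f hf (tmk X Y x y) = f x y := by
  simp [tlift, tmk]

@[ext high]
theorem tens_ext {X Y : NBimod N} {W : Type*} [AddCommGroup W] [Module ℂ W]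
    {f g : Tens X Y →ₗ[ℂ] W} (h : (tmk X Y).compr₂ f = (tmk X Y).compr₂ g) : f = g := by
  apply Submodule.linearMap_qext
  apply TensorProduct.ext
  exact h

@[elab_as_elim]
theorem tens_induction {X Y : NBimod N} {p : Tens X Y → Prop} (t : Tens X Y)
    (tmk : ∀ x y, p (tmk X Y x y)) (add : ∀ s t, p s → p t → p (s + t)) : p t := by
  obtain ⟨t, rfl⟩ := (balanced X Y).mkQ_surjective t
  induction t using TensorProduct.induction_on with
  | zero => simpa using tmk 0 0
  | tmul x y => exact tmk x y
  | add s t hs ht => rw [map_add]; exact add _ _ hs ht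

/-- The map of tensor products induced by two linear maps compatible with the inner actions. -/
def tmap {X Y X' Y' : NBimod N} (f : X →ₗ[ℂ] X') (g : Y →ₗ[ℂ] Y')
    (hf : ∀ (a : Nᵐᵒᵖ) (x : X), f (X.right a x) = X'.right a (f x))
    (hg : ∀ (a : N) (y : Y), g (Y.left a y) = Y'.left a (g y)) : Tens X Y →ₗ[ℂ] Tens X' Y' :=
  tlift ((tmk X' Y').compl₁₂ f g) fun x a y => by simp [hf, hg, tmk_balanced]

@[simp] theorem tmap_tmk {X Y X' Y' : NBimod N} (f : X →ₗ[ℂ] X') (g : Y →ₗ[ℂ] Y') (hf) (hg)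
    (x : X) (y : Y) : tmap f g hf hg (tmk X Y x y) = tmk X' Y' (f x) (g y) := by
  simp [tmap]

/-- The bimodule `X ⊗_N Y`. -/
def tensor (X Y : NBimod N) : NBimod N where
  carrier := Tens X Y
  left := AlgHom.ofLinearMap
    { toFun := fun a => tmap (X.left a) LinearMap.id (fun b x => X.left_right a b x)
        (fun _ _ => rfl)
      map_add' := fun a b => by ext; simp
      map_smul' := fun c a => by ext; simp }
    (by ext; simp) (fun a b => by ext; simp)
  right := AlgHom.ofLinearMap
    { toFun := fun a => tmap LinearMap.id (Y.right a) (fun _ _ => rfl)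
        (fun b y => (Y.left_right b a y).symm)
      map_add' := fun a b => by ext; simp
      map_smul' := fun c a => by ext; simp }
    (by ext; simp) (fun a b => by ext; simp)
  left_right a b t := by
    induction t using tens_induction with
    | tmk x y => simp
    | add s t hs ht => simp only [map_add, hs, ht]

/-- The canonical bilinear map `(x, y) ↦ x ⊗ y` into the bimodule `X ⊗_N Y`. -/
def tm (X Y : NBimod N) : X →ₗ[ℂ] Y →ₗ[ℂ] tensor X Y := tmk X Y

theorem tm_balanced {X Y : NBimod N} (x : X) (a : N) (y : Y) :
    tm X Y (X.right (.op a) x) y = tm X Y x (Y.left a y) := tmk_balanced x a y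

@[simp] theorem tensor_left {X Y : NBimod N} (a : N) (x : X) (y : Y) :
    (tensor X Y).left a (tm X Y x y) = tm X Y (X.left a x) y :=
  tmap_tmk (X.left a) LinearMap.id (fun b x => X.left_right a b x) (fun _ _ => rfl) x y

@[simp] theorem tensor_right {X Y : NBimod N} (a : Nᵐᵒᵖ) (x : X) (y : Y) :
    (tensor X Y).right a (tm X Y x y) = tm X Y x (Y.right a y) :=
  tmap_tmk LinearMap.id (Y.right a) (fun _ _ => rfl) (fun b y => (Y.left_right b a y).symm) x y

@[elab_as_elim]
theorem tensor_induction {X Y : NBimod N} {p : tensor X Y → Prop} (t : tensor X Y)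
    (tm : ∀ x y, p (tm X Y x y)) (add : ∀ s t, p s → p t → p (s + t)) : p t :=
  tens_induction t tm add

@[ext high]
theorem tensor_ext {X Y : NBimod N} {W : Type*} [AddCommGroup W] [Module ℂ W]
    {f g : tensor X Y →ₗ[ℂ] W} (h : (tm X Y).compr₂ f = (tm X Y).compr₂ g) : f = g :=
  tens_ext h

/-- The linear map on the bimodule `X ⊗_N Y` induced by a balanced bilinear map. -/
def lift {X Y : NBimod N} {W : Type u} [AddCommGroup W] [Module ℂ W] (f : X →ₗ[ℂ] Y →ₗ[ℂ] W)
    (hf : ∀ x a y, f (X.right (.op a) x) y = f x (Y.left a y)) : tensor X Y →ₗ[ℂ] W :=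
  tlift f hf

@[simp] theorem lift_tm {X Y : NBimod N} {W : Type u} [AddCommGroup W] [Module ℂ W]
    (f : X →ₗ[ℂ] Y →ₗ[ℂ] W) (hf) (x : X) (y : Y) : lift f hf (tm X Y x y) = f x y :=
  tlift_tmk f hf x y

/-- The morphism `f ⊗ g`. -/
def tensorMap {X Y X' Y' : NBimod N} (f : X ⟶ X') (g : Y ⟶ Y') : tensor X Y ⟶ tensor X' Y' :=
  ofLin (X := tensor X Y) (Y := tensor X' Y')
    (lift ((tm X' Y').compl₁₂ (lin f) (lin g)) fun x a y => by
      simp [lin_left, lin_right, tm_balanced])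
    (fun a t => by
      induction t using tensor_induction with
      | tm x y => simp [lin_left]
      | add s t hs ht => simp only [map_add, hs, ht])
    (fun a t => by
      induction t using tensor_induction with
      | tm x y => simp [lin_right]
      | add s t hs ht => simp only [map_add, hs, ht])

@[simp] theorem tensorMap_tm {X Y X' Y' : NBimod N} (f : X ⟶ X') (g : Y ⟶ Y') (x : X) (y : Y) :
    lin (tensorMap f g) (tm X Y x y) = tm X' Y' (lin f x) (lin g y) := by
  simp [tensorMap]

/-- The regular bimodule `N`, the unit for `⊗_N`. -/
def unit (N : Type u) [Ring N] [Algebra ℂ N] : NBimod N where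
  carrier := N
  left := Algebra.lmul ℂ N
  right := Algebra.lsmul ℂ ℂ N
  left_right a b x := by simp [mul_assoc]

/-- The identity, from `N` to the regular bimodule. -/
def toUnit (N : Type u) [Ring N] [Algebra ℂ N] : N ≃ₗ[ℂ] unit N := LinearEquiv.refl ℂ N

@[simp] theorem unit_left (a b : N) :
    (unit N).left a (toUnit N b) = toUnit N (a * b) := rfl

@[simp] theorem unit_right (a : Nᵐᵒᵖ) (b : N) :
    (unit N).right a (toUnit N b) = toUnit N (b * a.unop) := rfl

@[ext high]
theorem unit_ext {W : Type*} [AddCommGroup W] [Module ℂ W] {f g : unit N →ₗ[ℂ] W}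
    (h : f ∘ₗ (toUnit N).toLinearMap = g ∘ₗ (toUnit N).toLinearMap) : f = g := h

theorem tm_unit_left {X : NBimod N} (a b : N) (x : X) :
    tm (unit N) X (toUnit N (a * b)) x = tm (unit N) X (toUnit N a) (X.left b x) :=
  tm_balanced (X := unit N) (toUnit N a) b x

theorem tm_unit_right {X : NBimod N} (a b : N) (x : X) :
    tm X (unit N) x (toUnit N (a * b)) = tm X (unit N) (X.right (.op a) x) (toUnit N b) :=
  (tm_balanced (Y := unit N) x a (toUnit N b)).symm

/-- `(x ⊗ y) ⊗ z ↦ x ⊗ (y ⊗ z)` -/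
def assocHom (X Y Z : NBimod N) : tensor (tensor X Y) Z ⟶ tensor X (tensor Y Z) :=
  ofLin (X := tensor (tensor X Y) Z) (Y := tensor X (tensor Y Z))
    (lift
      (lift (LinearMap.mk₂ ℂ (fun x y => tm X (tensor Y Z) x ∘ₗ tm Y Z y)
        (fun _ _ _ => by ext; simp) (fun _ _ _ => by ext; simp) (fun _ _ _ => by ext; simp)
        (fun _ _ _ => by ext; simp)) (fun x a y => by ext z; simp [tm_balanced]))
      (fun t a z => by
        induction t using tensor_induction with
        | tm x y => simp [tm_balanced]
        | add s t hs ht => simp only [map_add, LinearMap.add_apply, hs, ht]))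
    (fun a t => by
      induction t using tensor_induction with
      | tm t z =>
        induction t using tensor_induction with
        | tm x y => simp
        | add s t hs ht => simp only [map_add, LinearMap.add_apply, hs, ht]
      | add s t hs ht => simp only [map_add, hs, ht])
    (fun a t => by
      induction t using tensor_induction with
      | tm t z =>
        induction t using tensor_induction with
        | tm x y => simp
        | add s t hs ht => simp only [map_add, LinearMap.add_apply, hs, ht]
      | add s t hs ht => simp only [map_add, hs, ht])

@[simp] theorem assocHom_tm {X Y Z : NBimod N} (x : X) (y : Y) (z : Z) :
    lin (assocHom X Y Z) (tm (tensor X Y) Z (tm X Y x y) z) =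
      tm X (tensor Y Z) x (tm Y Z y z) := by
  simp [assocHom]

/-- `x ⊗ (y ⊗ z) ↦ (x ⊗ y) ⊗ z` -/
def assocInv (X Y Z : NBimod N) : tensor X (tensor Y Z) ⟶ tensor (tensor X Y) Z :=
  ofLin (X := tensor X (tensor Y Z)) (Y := tensor (tensor X Y) Z)
    (lift
      (LinearMap.flip (lift (LinearMap.mk₂ ℂ
        (fun y z => (tm (tensor X Y) Z).flip z ∘ₗ (tm X Y).flip y)
        (fun _ _ _ => by ext; simp) (fun _ _ _ => by ext; simp) (fun _ _ _ => by ext; simp)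
        (fun _ _ _ => by ext; simp))
        (fun y a z => by
          ext x
          simp [← tm_balanced (X := tensor X Y)])))
      (fun x a t => by
        induction t using tensor_induction with
        | tm y z => simp [tm_balanced]
        | add s t hs ht => simp only [map_add, hs, ht]))
    (fun a t => by
      induction t using tensor_induction with
      | tm x t =>
        induction t using tensor_induction with
        | tm y z => simp
        | add s t hs ht => simp only [map_add, hs, ht]
      | add s t hs ht => simp only [map_add, hs, ht])
    (fun a t => by
      induction t using tensor_induction with
      | tm x t =>
        induction t using tensor_induction with
        | tm y z => simp
        | add s t hs ht => simp only [map_add, hs, ht]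
      | add s t hs ht => simp only [map_add, hs, ht])

@[simp] theorem assocInv_tm {X Y Z : NBimod N} (x : X) (y : Y) (z : Z) :
    lin (assocInv X Y Z) (tm X (tensor Y Z) x (tm Y Z y z)) =
      tm (tensor X Y) Z (tm X Y x y) z := by
  simp [assocInv]

/-- `a ⊗ x ↦ a · x` -/
def leftHom (X : NBimod N) : tensor (unit N) X ⟶ X :=
  ofLin (X := tensor (unit N) X)
    (lift (X.left.toLinearMap ∘ₗ (toUnit N).symm.toLinearMap) (fun x a y => by
      obtain ⟨x, rfl⟩ := (toUnit N).surjective x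
      simp))
    (fun a t => by
      induction t using tensor_induction with
      | tm x y =>
        obtain ⟨x, rfl⟩ := (toUnit N).surjective x
        simp
      | add s t hs ht => simp only [map_add, hs, ht])
    (fun a t => by
      induction t using tensor_induction with
      | tm x y => simp [X.left_right]
      | add s t hs ht => simp only [map_add, hs, ht])

@[simp] theorem leftHom_tm {X : NBimod N} (a : N) (x : X) :
    lin (leftHom X) (tm (unit N) X (toUnit N a) x) = X.left a x := by
  simp [leftHom]

/-- `x ↦ 1 ⊗ x` -/
def leftInv (X : NBimod N) : X ⟶ tensor (unit N) X :=
  ofLin (Y := tensor (unit N) X) (tm (unit N) X (toUnit N 1))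
    (fun a x => by rw [tensor_left, ← tm_unit_left]; simp)
    (fun a x => by simp)

@[simp] theorem leftInv_apply {X : NBimod N} (x : X) :
    lin (leftInv X) x = tm (unit N) X (toUnit N 1) x := rfl

/-- `x ⊗ a ↦ x · a` -/
def rightHom (X : NBimod N) : tensor X (unit N) ⟶ X :=
  ofLin (X := tensor X (unit N))
    (lift (X.right.toLinearMap.flip.compl₂
        ((MulOpposite.opLinearEquiv ℂ).toLinearMap ∘ₗ (toUnit N).symm.toLinearMap))
      (fun x a y => by
        obtain ⟨y, rfl⟩ := (toUnit N).surjective y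
        simp))
    (fun a t => by
      induction t using tensor_induction with
      | tm x y => simp [X.left_right]
      | add s t hs ht => simp only [map_add, hs, ht])
    (fun a t => by
      induction t using tensor_induction with
      | tm x y =>
        obtain ⟨y, rfl⟩ := (toUnit N).surjective y
        simp
      | add s t hs ht => simp only [map_add, hs, ht])

@[simp] theorem rightHom_tm {X : NBimod N} (x : X) (a : N) :
    lin (rightHom X) (tm X (unit N) x (toUnit N a)) = X.right (.op a) x := by
  simp [rightHom]

/-- `x ↦ x ⊗ 1` -/
def rightInv (X : NBimod N) : X ⟶ tensor X (unit N) :=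
  ofLin (Y := tensor X (unit N)) ((tm X (unit N)).flip (toUnit N 1))
    (fun a x => by simp)
    (fun a x => by
      have h := tm_unit_right a.unop 1 x
      simp only [LinearMap.flip_apply, tensor_right, unit_right, one_mul]
      rw [← mul_one a.unop, h]
      simp)

@[simp] theorem rightInv_apply {X : NBimod N} (x : X) :
    lin (rightInv X) x = tm X (unit N) x (toUnit N 1) := rfl

instance : MonoidalCategoryStruct (NBimod N) where
  tensorObj := tensor
  whiskerLeft X _ _ f := tensorMap (𝟙 X) f
  whiskerRight f Y := tensorMap f (𝟙 Y)
  tensorHom f g := tensorMap f g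
  tensorUnit := unit N
  associator X Y Z :=
    { hom := assocHom X Y Z
      inv := assocInv X Y Z
      hom_inv_id := by ext x y z; simp
      inv_hom_id := by
        ext x y z
        simp }
  leftUnitor X :=
    { hom := leftHom X
      inv := leftInv X
      hom_inv_id := by ext a x; simp [← tm_unit_left]
      inv_hom_id := by ext x; simp }
  rightUnitor X :=
    { hom := rightHom X
      inv := rightInv X
      hom_inv_id := by ext x a; simp [← tm_unit_right]
      inv_hom_id := by ext x; simp }

theorem tensorObj_def (X Y : NBimod N) : X ⊗ Y = tensor X Y := rfl
theorem tensorUnit_def : 𝟙_ (NBimod N) = unit N := rfl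
theorem tensorHom_def' {X Y X' Y' : NBimod N} (f : X ⟶ X') (g : Y ⟶ Y') :
    f ⊗ₘ g = tensorMap f g := rfl
theorem whiskerLeft_def (X : NBimod N) {Y Y' : NBimod N} (g : Y ⟶ Y') :
    X ◁ g = tensorMap (𝟙 X) g := rfl
theorem whiskerRight_def {X X' : NBimod N} (f : X ⟶ X') (Y : NBimod N) :
    f ▷ Y = tensorMap f (𝟙 Y) := rfl
theorem associator_hom_def (X Y Z : NBimod N) : (α_ X Y Z).hom = assocHom X Y Z := rfl
theorem leftUnitor_hom_def (X : NBimod N) : (λ_ X).hom = leftHom X := rfl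
theorem rightUnitor_hom_def (X : NBimod N) : (ρ_ X).hom = rightHom X := rfl

@[ext high]
theorem tensor_hom_ext {X Y Z : NBimod N} {f g : tensor X Y ⟶ Z}
    (h : (tm X Y).compr₂ (lin f) = (tm X Y).compr₂ (lin g)) : f = g := hom_ext (tensor_ext h)

instance : MonoidalCategory (NBimod N) :=
  MonoidalCategory.ofTensorHom
    (id_tensorHom_id := fun X Y => by
      change tensorMap (𝟙 X) (𝟙 Y) = 𝟙 (tensor X Y)
      ext x y
      simp)
    (id_tensorHom := fun _ _ _ _ => rfl)
    (tensorHom_id := fun _ _ => rfl)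
    (tensorHom_comp_tensorHom := fun {X Y Z X' Y' Z'} f f' g g' => by
      change tensorMap f f' ≫ tensorMap g g' = tensorMap (f ≫ g) (f' ≫ g')
      ext x y
      simp)
    (associator_naturality := fun f g h => by
      change tensorMap (tensorMap f g) h ≫ assocHom _ _ _ =
        assocHom _ _ _ ≫ tensorMap f (tensorMap g h)
      ext x y z
      simp)
    (leftUnitor_naturality := fun f => by
      change tensorMap (𝟙 (unit N)) f ≫ leftHom _ = leftHom _ ≫ f
      ext a x
      simp [lin_left])
    (rightUnitor_naturality := fun f => by
      change tensorMap f (𝟙 (unit N)) ≫ rightHom _ = rightHom _ ≫ f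
      ext x a
      simp [lin_right])
    (pentagon := fun W X Y Z => by
      change tensorMap (assocHom W X Y) (𝟙 Z) ≫ assocHom W (tensor X Y) Z ≫
          tensorMap (𝟙 W) (assocHom X Y Z) =
        assocHom (tensor W X) Y Z ≫ assocHom W X (tensor Y Z)
      ext w x y z
      simp)
    (triangle := fun X Y => by
      change assocHom X (unit N) Y ≫ tensorMap (𝟙 X) (leftHom Y) = tensorMap (rightHom X) (𝟙 Y)
      ext x a y
      simp [tm_balanced])

instance : MonoidalPreadditive (NBimod N) where
  whiskerLeft_zero {X Y Z} := by
    change tensorMap (𝟙 X) (0 : Y ⟶ Z) = 0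
    ext x y; simp
  zero_whiskerRight {X Y Z} := by
    change tensorMap (0 : Y ⟶ Z) (𝟙 X) = 0
    ext x y; simp
  whiskerLeft_add {X Y Z} f g := by
    change tensorMap (𝟙 X) (f + g) = tensorMap (𝟙 X) f + tensorMap (𝟙 X) g
    ext x y; simp
  add_whiskerRight {X Y Z} f g := by
    change tensorMap (f + g) (𝟙 X) = tensorMap f (𝟙 X) + tensorMap g (𝟙 X)
    ext x y; simp

instance : MonoidalLinear ℂ (NBimod N) where
  whiskerLeft_smul X {Y Z} c f := by
    change tensorMap (𝟙 X) (c • f) = c • tensorMap (𝟙 X) f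
    ext x y; simp
  smul_whiskerRight c {Y Z} f X := by
    change tensorMap (c • f) (𝟙 X) = c • tensorMap f (𝟙 X)
    ext x y; simp

/-! An algebra `M` under `N` is an algebra object in the category of `N`-bimodules. -/

section AlgObj

variable {M : Type u} [Ring M] [Algebra ℂ M] (i : N →ₐ[ℂ] M)

/-- The algebra `M` as a bimodule over `N`. -/
def ofAlgHom : NBimod N where
  carrier := M
  left := (Algebra.lmul ℂ M).comp i
  right := (Algebra.lsmul ℂ ℂ M).comp (AlgHom.op i)
  left_right a b x := by simp [mul_assoc]

/-- The identity, from the algebra `M` to the bimodule `M`. -/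
def toBimod : M ≃ₗ[ℂ] ofAlgHom i := LinearEquiv.refl ℂ M

@[simp] theorem ofAlgHom_left (a : N) (x : M) :
    (ofAlgHom i).left a (toBimod i x) = toBimod i (i a * x) := rfl

@[simp] theorem ofAlgHom_right (a : Nᵐᵒᵖ) (x : M) :
    (ofAlgHom i).right a (toBimod i x) = toBimod i (x * i a.unop) := rfl

@[ext high]
theorem ofAlgHom_ext {W : Type*} [AddCommGroup W] [Module ℂ W] {f g : ofAlgHom i →ₗ[ℂ] W}
    (h : f ∘ₗ (toBimod i).toLinearMap = g ∘ₗ (toBimod i).toLinearMap) : f = g := h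

/-- The unit `N ⟶ M`, `a ↦ i a`. -/
def algOne : unit N ⟶ ofAlgHom i :=
  ofLin (X := unit N) (Y := ofAlgHom i)
    ((toBimod i).toLinearMap ∘ₗ i.toLinearMap ∘ₗ (toUnit N).symm.toLinearMap)
    (fun a b => by
      obtain ⟨b, rfl⟩ := (toUnit N).surjective b
      simp)
    (fun a b => by
      obtain ⟨b, rfl⟩ := (toUnit N).surjective b
      simp)

@[simp] theorem algOne_apply (a : N) : lin (algOne i) (toUnit N a) = toBimod i (i a) := rfl

/-- The multiplication `M ⊗_N M ⟶ M`, `x ⊗ y ↦ x y`. -/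
def algMul : tensor (ofAlgHom i) (ofAlgHom i) ⟶ ofAlgHom i :=
  ofLin (X := tensor (ofAlgHom i) (ofAlgHom i)) (Y := ofAlgHom i)
    (lift (((LinearMap.mul ℂ M).compl₁₂ (toBimod i).symm.toLinearMap
        (toBimod i).symm.toLinearMap).compr₂ (toBimod i).toLinearMap)
      (fun x a y => by
        obtain ⟨x, rfl⟩ := (toBimod i).surjective x
        obtain ⟨y, rfl⟩ := (toBimod i).surjective y
        simp [mul_assoc]))
    (fun a t => by
      induction t using tensor_induction with
      | tm x y =>
        obtain ⟨x, rfl⟩ := (toBimod i).surjective x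
        obtain ⟨y, rfl⟩ := (toBimod i).surjective y
        simp [mul_assoc]
      | add s t hs ht => simp only [map_add, hs, ht])
    (fun a t => by
      induction t using tensor_induction with
      | tm x y =>
        obtain ⟨x, rfl⟩ := (toBimod i).surjective x
        obtain ⟨y, rfl⟩ := (toBimod i).surjective y
        simp [mul_assoc]
      | add s t hs ht => simp only [map_add, hs, ht])

@[simp] theorem algMul_tm (x y : M) :
    lin (algMul i) (tm (ofAlgHom i) (ofAlgHom i) (toBimod i x) (toBimod i y)) =
      toBimod i (x * y) := by
  simp [algMul]

instance : MonObj (ofAlgHom i) where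
  one := algOne i
  mul := algMul i
  one_mul := by
    change tensorMap (algOne i) (𝟙 (ofAlgHom i)) ≫ algMul i = leftHom (ofAlgHom i)
    ext a x
    simp
  mul_one := by
    change tensorMap (𝟙 (ofAlgHom i)) (algOne i) ≫ algMul i = rightHom (ofAlgHom i)
    ext x a
    simp
  mul_assoc := by
    change tensorMap (algMul i) (𝟙 (ofAlgHom i)) ≫ algMul i =
      assocHom _ _ _ ≫ tensorMap (𝟙 (ofAlgHom i)) (algMul i) ≫ algMul i
    ext x y z
    simp [mul_assoc]

end AlgObj

/-! ### Involutions -/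

/-- A `*`-structure on an algebra object `X` in the category of bimodules over a `*`-algebra: an
involutive conjugate-linear map `σ` of `X` with `σ (a · x) = σ x · a*`, i.e. an involutive
isomorphism from `X` to its conjugate bimodule, which reverses the multiplication. -/
structure StarStructure [StarRing N] (X : NBimod N) [MonObj X] where
  σ : X →ₗ⋆[ℂ] X
  involutive : ∀ x, σ (σ x) = x
  map_left : ∀ (a : N) (x : X), σ (X.left a x) = X.right (.op (star a)) (σ x)
  map_mul : ∀ x y : X, σ (lin (X := tensor X X) (MonObj.mul (X := X)) (tm X X x y)) =
    lin (X := tensor X X) (MonObj.mul (X := X)) (tm X X (σ y) (σ x))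

theorem StarStructure.map_right [StarRing N] {X : NBimod N} [MonObj X] (s : StarStructure X)
    (a : Nᵐᵒᵖ) (x : X) : s.σ (X.right a x) = X.left (star a.unop) (s.σ x) := by
  have h := s.map_left (star a.unop) (s.σ x)
  rw [s.involutive, star_star, MulOpposite.op_unop] at h
  rw [← h, s.involutive]

/-- The conjugate `σ ∘ f ∘ σ` of an endomorphism `f`. -/
def StarStructure.conj [StarRing N] {X : NBimod N} [MonObj X] (s : StarStructure X)
    (f : End X) : End X :=
  ofLin (X := X) (Y := X) (s.σ.comp ((lin f).comp s.σ) : X →ₗ[ℂ] X)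
    (fun a x => by simp [s.map_left, s.map_right, lin_right])
    (fun a x => by simp [s.map_left, s.map_right, lin_left])

/-- The involution of a `*`-algebra `M` under the `*`-algebra `N`. -/
def starStructure [StarRing N] {M : Type u} [Ring M] [Algebra ℂ M] [StarRing M] [StarModule ℂ M]
    (i : N →⋆ₐ[ℂ] M) : StarStructure (ofAlgHom (i : N →ₐ[ℂ] M)) where
  σ :=
    { toFun := fun x => toBimod _ (star ((toBimod (i : N →ₐ[ℂ] M)).symm x))
      map_add' := fun x y => by simp
      map_smul' := fun c x => by simp }
  involutive x := by simp
  map_left a x := by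
    obtain ⟨x, rfl⟩ := (toBimod (i : N →ₐ[ℂ] M)).surjective x
    simp [map_star]
  map_mul x y := by
    obtain ⟨x, rfl⟩ := (toBimod (i : N →ₐ[ℂ] M)).surjective x
    obtain ⟨y, rfl⟩ := (toBimod (i : N →ₐ[ℂ] M)).surjective y
    have h (x y : M) : lin (X := tensor (ofAlgHom (i : N →ₐ[ℂ] M)) (ofAlgHom (i : N →ₐ[ℂ] M)))
        (MonObj.mul (X := ofAlgHom (i : N →ₐ[ℂ] M))) (tm _ _ (toBimod _ x) (toBimod _ y)) =
        toBimod _ (x * y) := algMul_tm _ x y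
    simp [h]

end NBimod

/-! ### Hopf `*`-algebras -/

/-- Hopf `*`-algebras over the complex numbers. The involution on a tensor product is
`(a ⊗ b)* = a* ⊗ b*`. -/
structure HopfStarAlg where
  carrier : Type u
  [ring : Ring carrier]
  [hopf : HopfAlgebra ℂ carrier]
  [starRing : StarRing carrier]
  [starModule : StarModule ℂ carrier]
  comul_star : ∀ h : carrier, Coalgebra.comul (R := ℂ) (star h) = star (Coalgebra.comul (R := ℂ) h)
  antipode_star : ∀ h : carrier,
    star (HopfAlgebra.antipode ℂ (star (HopfAlgebra.antipode ℂ h))) = h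

namespace HopfStarAlg

attribute [instance] ring hopf starRing starModule

instance : CoeSort HopfStarAlg.{u} (Type u) := ⟨carrier⟩

/-- Morphisms of Hopf `*`-algebras. They are automatically compatible with the antipodes. -/
@[ext]
structure Hom (P Q : HopfStarAlg.{u}) where
  toBialgHom : P →ₐc[ℂ] Q
  map_star : ∀ h, toBialgHom (star h) = star (toBialgHom h)

instance : Category HopfStarAlg.{u} where
  Hom P Q := Hom P Q
  id P := ⟨BialgHom.id ℂ P, fun _ => rfl⟩
  comp f g := ⟨g.toBialgHom.comp f.toBialgHom, fun h => by simp [f.map_star, g.map_star]⟩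

/-- The function underlying a morphism of Hopf `*`-algebras. -/
def app {P Q : HopfStarAlg.{u}} (f : P ⟶ Q) : P → Q := (Hom.toBialgHom f : P → Q)

@[ext]
theorem hom_ext {P Q : HopfStarAlg.{u}} {f g : P ⟶ Q} (h : ∀ x, app f x = app g x) : f = g :=
  Hom.ext (BialgHom.ext h)

@[simp] theorem app_id (P : HopfStarAlg.{u}) (x : P) : app (𝟙 P) x = x := rfl

@[simp] theorem app_comp {P Q R : HopfStarAlg.{u}} (f : P ⟶ Q) (g : Q ⟶ R) (x : P) :
    app (f ≫ g) x = app g (app f x) := rfl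

end HopfStarAlg

/-! ### The quantum Galois group of an inclusion -/

/-- An action of a Hopf `*`-algebra `Q` on a `*`-algebra `M` that makes `M` a
module `*`-algebra. -/
structure ModuleStarAction (Q : HopfStarAlg.{u}) (M : Type u) [Ring M] [Algebra ℂ M]
    [StarRing M] where
  act : Q →ₐ[ℂ] Module.End ℂ M
  /-- `h · (x y) = (h₁ · x) (h₂ · y)` -/
  act_mul : ∀ (h : Q) (x y : M), act h (x * y) =
    LinearMap.mul' ℂ M (TensorProduct.map (act.toLinearMap.flip x) (act.toLinearMap.flip y)
      (Coalgebra.comul h))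
  act_one : ∀ h : Q, act h 1 = Coalgebra.counit (R := ℂ) h • (1 : M)
  star_act : ∀ (h : Q) (x : M), star (act h x) = act (star (HopfAlgebra.antipode ℂ h)) (star x)

namespace ModuleStarAction

variable {Q : HopfStarAlg.{u}} {M : Type u} [Ring M] [Algebra ℂ M] [StarRing M]

/-- The invariants `M^Q`. -/
def invariants (α : ModuleStarAction Q M) : Set M :=
  {x | ∀ h : Q, α.act h x = Coalgebra.counit (R := ℂ) h • x}

/-- The action preserves the functional `τ`. -/
def PreservesFunctional (α : ModuleStarAction Q M) (τ : M →ₗ[ℂ] ℂ) : Prop :=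
  ∀ (h : Q) (x : M), τ (α.act h x) = Coalgebra.counit (R := ℂ) h * τ x

end ModuleStarAction

section Galois

variable {N M : Type u} [Ring N] [Algebra ℂ N] [StarRing N]
  [Ring M] [Algebra ℂ M] [StarRing M] [StarModule ℂ M]

/-- The objects of the category `C(N ⊂ M)`, for an inclusion `i : N → M`: Hopf `*`-algebras
acting on `M` such that `N ⊂ M^Q`. -/
structure GaloisCat (i : N →⋆ₐ[ℂ] M) where
  hopf : HopfStarAlg.{u}
  action : ModuleStarAction hopf M
  fixes : Set.range i ⊆ action.invariants

namespace GaloisCat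

variable {i : N →⋆ₐ[ℂ] M}

/-- The morphisms of `C(N ⊂ M)`: the morphisms of Hopf `*`-algebras that intertwine
the actions. -/
@[ext]
structure Hom (P Q : GaloisCat i) where
  hom : P.hopf ⟶ Q.hopf
  comm : ∀ h : P.hopf, Q.action.act (HopfStarAlg.app hom h) = P.action.act h

instance : Category (GaloisCat i) where
  Hom P Q := Hom P Q
  id P := ⟨𝟙 P.hopf, fun h => by simp⟩
  comp f g := ⟨f.hom ≫ g.hom, fun h => by simp [f.comm, g.comm]⟩

/-- The objects of `C_τ(N ⊂ M)`: those with a `τ`-preserving action. -/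
def preserving (i : N →⋆ₐ[ℂ] M) (τ : M →ₗ[ℂ] ℂ) : ObjectProperty (GaloisCat i) :=
  fun Q => Q.action.PreservesFunctional τ

end GaloisCat

end Galois

/-! ### Hopf actions on algebra objects in monoidal categories -/

section HopfAction

open MonObj

variable {C : Type*} [Category* C] [Preadditive C] [Linear ℂ C] [MonoidalCategory C]
  [MonoidalPreadditive C] [MonoidalLinear ℂ C]

theorem smul_tensorHom {X Y X' Y' : C} (c : ℂ) (f : X ⟶ Y) (g : X' ⟶ Y') :
    (c • f) ⊗ₘ g = c • (f ⊗ₘ g) := by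
  simp [MonoidalCategory.tensorHom_def]

theorem tensorHom_smul {X Y X' Y' : C} (c : ℂ) (f : X ⟶ Y) (g : X' ⟶ Y') :
    f ⊗ₘ (c • g) = c • (f ⊗ₘ g) := by
  simp [MonoidalCategory.tensorHom_def]

/-- The canonical map `End X ⊗ End X → End (X ⊗ X)`. -/
def endTensor (X : C) : End X ⊗[ℂ] End X →ₗ[ℂ] End (X ⊗ X) :=
  TensorProduct.lift (LinearMap.mk₂ ℂ (fun f g : End X => (f ⊗ₘ g : X ⊗ X ⟶ X ⊗ X))
    (fun f f' g => MonoidalPreadditive.add_tensor f f' g)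
    (fun c f g => smul_tensorHom c f g)
    (fun f g g' => MonoidalPreadditive.tensor_add f g g')
    (fun c f g => tensorHom_smul c f g))

/-- A Hopf action on an algebra object `A` in a monoidal category: an algebra map
`ρ : Q → End A` compatible with the multiplication and the unit of `A`. -/
structure HopfAction (Q : HopfStarAlg.{u}) (A : C) [MonObj A] where
  ρ : Q →ₐ[ℂ] End A
  mul_compat : ∀ h : Q, μ[A] ≫ ρ h =
    endTensor A (TensorProduct.map ρ.toLinearMap ρ.toLinearMap (Coalgebra.comul h)) ≫ μ[A]
  one_compat : ∀ h : Q, η[A] ≫ ρ h = Coalgebra.counit (R := ℂ) h • η[A]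

/-- The action on `A` leaves the morphism `φ : A ⟶ B` invariant. -/
def HopfAction.PreservesHom {Q : HopfStarAlg.{u}} {A : C} [MonObj A] (ρ : HopfAction Q A)
    {B : C} (φ : A ⟶ B) : Prop :=
  ∀ h : Q, ρ.ρ h ≫ φ = Coalgebra.counit (R := ℂ) h • φ

end HopfAction

section QuantumAut

variable {N : Type u} [Ring N] [Algebra ℂ N] [StarRing N]

/-- The category of Hopf `*`-algebras acting on an algebra object `A` with `*`-structure in the
category of `N`-bimodules. A terminal object is a quantum automorphism group of `A`. -/
structure QAutCat (A : NBimod N) [MonObj A] (s : A.StarStructure) where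
  hopf : HopfStarAlg.{u}
  action : HopfAction hopf A
  /-- the action is compatible with the involutions: `S(h)*` acts as the conjugate of `h` -/
  star_compat : ∀ h : hopf, action.ρ (star (HopfAlgebra.antipode ℂ h)) = s.conj (action.ρ h)

namespace QAutCat

variable {A : NBimod N} [MonObj A] {s : A.StarStructure}

/-- Morphisms of Hopf `*`-algebras that intertwine the actions. -/
@[ext]
structure Hom (P Q : QAutCat A s) where
  hom : P.hopf ⟶ Q.hopf
  comm : ∀ h : P.hopf, Q.action.ρ (HopfStarAlg.app hom h) = P.action.ρ h

instance : Category (QAutCat A s) where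
  Hom P Q := Hom P Q
  id P := ⟨𝟙 P.hopf, fun h => by simp⟩
  comp f g := ⟨f.hom ≫ g.hom, fun h => by simp [f.comm, g.comm]⟩

/-- The objects whose action leaves the morphism `φ : A ⟶ B` invariant. -/
def preserving (s : A.StarStructure) {B : NBimod N} (φ : A ⟶ B) : ObjectProperty (QAutCat A s) :=
  fun Q => Q.action.PreservesHom φ

end QAutCat

end QuantumAut

/-! ### Finite factors -/

section Factors

variable {H : Type u} [NormedAddCommGroup H] [InnerProductSpace ℂ H] [CompleteSpace H]

/-- A finite factor: a nonzero von Neumann algebra with trivial centre in which every isometry is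
unitary. -/
structure IsFiniteFactor (M : VonNeumannAlgebra H) : Prop where
  one_ne_zero : (1 : H →L[ℂ] H) ≠ 0
  centre : ∀ x ∈ M, x ∈ M.commutant → ∃ c : ℂ, x = c • (1 : H →L[ℂ] H)
  finite : ∀ v ∈ M, star v * v = 1 → v * star v = 1

/-- `τ` is a faithful normal tracial state on `M`. -/
structure IsFaithfulNormalTrace (M : VonNeumannAlgebra H)
    (τ : M.toStarSubalgebra →ₗ[ℂ] ℂ) : Prop where
  one : τ 1 = 1
  nonneg : ∀ x, 0 ≤ τ (star x * x)
  trace : ∀ x y, τ (x * y) = τ (y * x)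
  faithful : ∀ x, τ (star x * x) = 0 → x = 0
  /-- `τ` preserves suprema of bounded directed sets of positive elements -/
  normal : ∀ (S : Set M.toStarSubalgebra) (s : M.toStarSubalgebra), S.Nonempty →
    DirectedOn (· ≤ ·) S → (∀ x ∈ S, 0 ≤ x) → IsLUB S s →
    IsLUB ((fun x => (τ x).re) '' S) (τ s).re

variable {N M : VonNeumannAlgebra H}

/-- The inclusion of `N` in `M`. -/
abbrev factorInclusion (hNM : N ≤ M) : N.toStarSubalgebra →⋆ₐ[ℂ] M.toStarSubalgebra :=
  StarSubalgebra.inclusion hNM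

/-- `M` as an algebra object in the monoidal category of `N`-bimodules. -/
abbrev factorObj (hNM : N ≤ M) : NBimod N.toStarSubalgebra :=
  NBimod.ofAlgHom (factorInclusion hNM : N.toStarSubalgebra →ₐ[ℂ] M.toStarSubalgebra)

/-- The `*`-structure of the algebra object `M`. -/
abbrev factorStar (hNM : N ≤ M) : (factorObj hNM).StarStructure :=
  NBimod.starStructure (factorInclusion hNM)

/-- `e` intertwines an action on `M` and an action on the algebra object `M`. -/
def Intertwines {hNM : N ≤ M} {Q : GaloisCat (factorInclusion hNM)}
    {R : QAutCat (factorObj hNM) (factorStar hNM)} (e : Q.hopf ≅ R.hopf) : Prop :=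
  ∀ (h : Q.hopf) (x : M.toStarSubalgebra),
    NBimod.lin (R.action.ρ (HopfStarAlg.app e.hom h)) (NBimod.toBimod _ x) =
      NBimod.toBimod _ (Q.action.act h x)

/-- `E` is the conditional expectation of `M` onto `N` that preserves `τ`: an `N`-bimodule map
which restricts to the identity of `N` and satisfies `τ ∘ E = τ`. -/
structure IsTraceExpectation (hNM : N ≤ M) (τ : M.toStarSubalgebra →ₗ[ℂ] ℂ)
    (E : factorObj hNM ⟶ 𝟙_ (NBimod N.toStarSubalgebra)) : Prop where
  unit : MonObj.one ≫ E = 𝟙 (𝟙_ (NBimod N.toStarSubalgebra))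
  trace : ∀ x : M.toStarSubalgebra,
    τ (factorInclusion hNM ((NBimod.toUnit _).symm (NBimod.lin E (NBimod.toBimod _ x)))) = τ x

end Factors

end

/-! The terminal object has to receive a map from every Hopf `*`-algebra acting on `M`, and these
form a class too large to take a colimit over. Instead, an element `h` of an object `Q` is replaced
by its matrix coefficients: the counit `ε(h)`, the operator by which `h` acts, and everything
obtained from these by iterating comultiplication, antipode and inverse antipode. The shapes of such
expressions form a small set (`CoeffIndex`), and the value of each shape lies in an algebra built
from `End M` and `ℂ` alone. So all objects map into one fixed product algebra, and `UnivAlg P` is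
the subalgebra generated by the images of those with property `P`.

Every structure map of `UnivAlg P` is a shift of indices: the antipode reads the coefficient at `op
a`, the involution the one at `a.conj`, and the comultiplication the ones at `node a b`. For the
comultiplication one also needs that an element of `UnivAlg P ⊗ UnivAlg P` is determined by its
pairs of coefficients (`tensorCoeff_injective`), which holds over a field. The axioms are inherited
from the generating objects and pass to products and sums.

Morphisms preserve coefficients (`coeff_hom`), and an element of `UnivAlg P` is its own family of
coefficients (`coeff_obj`). Hence there is at most one morphism into `UnivAlg.obj P`, and it exists
on every object with property `P`. This object is terminal as soon as it has property `P` itself.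

The comparison with the algebra object is a dictionary. Compatibility with `η : N → M` says that `N`
is fixed pointwise; conversely, a module algebra action that fixes `N` is by bimodule maps, since
`h·(nx) = (h₁·n)(h₂·x) = n(h·x)`. The two categories thus have the same objects and morphisms.
Preserving `τ` and preserving `E` agree because `τ ∘ E = τ` and `τ` is faithful (`preserving_iff`).
-/

noncomputable section


/-! ### Antipodes under bialgebra maps, and separating elements of tensor products -/

section HopfGeneral

open Coalgebra HopfAlgebra WithConv in
/-- Bialgebra morphisms between Hopf algebras commute with the antipodes. -/
theorem BialgHom.map_antipode {R A B : Type*} [CommSemiring R] [Semiring A] [Semiring B]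
    [HopfAlgebra R A] [HopfAlgebra R B] (f : A →ₐc[R] B) (x : A) :
    f (antipode R x) = antipode R (f x) := by
  have key : toConv ((f : A →ₗ[R] B) ∘ₗ antipode R) = toConv (antipode R ∘ₗ (f : A →ₗ[R] B)) := by
    symm
    -- In the convolution algebra of linear maps `A → B`, `S ∘ f` is a left inverse of `f` and `f ∘
    -- S` a right inverse.
    apply left_inv_eq_right_inv (a := toConv (f : A →ₗ[R] B))
    · ext y
      have h := mul_antipode_rTensor_comul_apply (R := R) (f y)
      rw [← CoalgHomClass.map_comp_comul_apply f y] at h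
      rw [(ℛ R y).convMul_apply]
      simpa [← (ℛ R y).eq] using h
    · ext y
      rw [(ℛ R y).convMul_apply]
      have h := congrArg f (sum_mul_antipode_eq_algebraMap_counit (ℛ R y))
      rw [AlgHomClass.commutes f] at h
      simpa [map_sum] using h
  exact LinearMap.congr_fun (congrArg ofConv key) x

/-- Over a field, an element of `V ⊗ W` that vanishes under all maps `p i ⊗ id` vanishes
if the maps `p i` are jointly injective. -/
theorem TensorProduct.eq_zero_of_rTensor {k : Type*} [Field k] {V W : Type*} [AddCommGroup V]
    [Module k V] [AddCommGroup W] [Module k W] {ι : Type*} {A : ι → Type*}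
    [∀ i, AddCommGroup (A i)] [∀ i, Module k (A i)] (p : ∀ i, V →ₗ[k] A i)
    (hp : ∀ v, (∀ i, p i v = 0) → v = 0) (t : V ⊗[k] W)
    (ht : ∀ i, (p i).rTensor W t = 0) : t = 0 := by
  classical
  -- Expanding `t` along a basis of `W` gives coordinates in `V`, and `p i ⊗ id` acts on them
  -- coordinatewise.
  let b := Module.Free.chooseBasis k W
  apply (TensorProduct.equivFinsuppOfBasisRight (M := V) b).injective
  ext j
  rw [map_zero, Finsupp.zero_apply]
  refine hp _ fun i => ?_
  have h : ∀ s : V ⊗[k] W, p i (TensorProduct.equivFinsuppOfBasisRight b s j) =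
      TensorProduct.equivFinsuppOfBasisRight b ((p i).rTensor W s) j := fun s => by
    induction s with
    | zero => simp
    | tmul v w => simp
    | add s s' hs hs' => simp [hs, hs']
  rw [h, ht, map_zero, Finsupp.zero_apply]

/-- One factor is treated at a time, with a flip of the tensor factors in between. Working with
families of maps avoids comparing a tensor product of infinite products with a product of tensor
products. -/
theorem TensorProduct.eq_zero_of_map {k : Type*} [Field k] {V W : Type*} [AddCommGroup V]
    [Module k V] [AddCommGroup W] [Module k W] {ι κ : Type*} {A : ι → Type*} {B : κ → Type*}
    [∀ i, AddCommGroup (A i)] [∀ i, Module k (A i)] [∀ j, AddCommGroup (B j)]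
    [∀ j, Module k (B j)] (p : ∀ i, V →ₗ[k] A i) (hp : ∀ v, (∀ i, p i v = 0) → v = 0)
    (q : ∀ j, W →ₗ[k] B j) (hq : ∀ w, (∀ j, q j w = 0) → w = 0) (t : V ⊗[k] W)
    (ht : ∀ i j, TensorProduct.map (p i) (q j) t = 0) : t = 0 := by
  refine TensorProduct.eq_zero_of_rTensor p hp t fun i => ?_
  rw [← (TensorProduct.comm k (A i) W).map_eq_zero_iff]
  refine TensorProduct.eq_zero_of_rTensor q hq _ fun j => ?_
  rw [← (TensorProduct.comm k (B j) (A i)).map_eq_zero_iff, ← ht i j]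
  generalize t = s
  induction s with
  | zero => simp
  | tmul v w => simp
  | add s s' hs hs' => simp only [map_add, hs, hs']

end HopfGeneral

/-! ### Counit, antipode and inverse antipode of a Hopf `*`-algebra -/

namespace HopfStarAlg

variable (Q : HopfStarAlg.{u})

/-- The inverse `h ↦ S(h*)*` of the antipode. -/
def antipodeInv : Q →ₗ[ℂ] Q where
  toFun h := star (HopfAlgebra.antipode ℂ (star h))
  map_add' := by simp
  map_smul' := by simp

/-- The counit is a `*`-map: both `ε` and `h ↦ ε(h*)*` are counits. -/
theorem counit_star (h : Q) :
    Coalgebra.counit (R := ℂ) (star h) = star (Coalgebra.counit (R := ℂ) h) := by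
  -- On `x ⊗ y` both sides equal `ε(x)* ε(y*)`. At `t = Δ(h)` the counit axiom collapses the left
  -- side to `ε(h*)` and, as `Δ` is a `*`-map, the right side to `ε(h)*`.
  have key : ∀ t : Q ⊗[ℂ] Q, Coalgebra.counit (R := ℂ)
      (star (TensorProduct.lid ℂ Q (Coalgebra.counit.rTensor _ t))) =
      star (Coalgebra.counit (R := ℂ) (star (TensorProduct.rid ℂ Q
        (LinearMap.lTensor _ Coalgebra.counit (star t))))) := fun t => by
    induction t with
    | zero => simp
    | tmul x y => simp [mul_comm]
    | add s t hs ht => simp only [star_add, map_add, hs, ht]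
  have := key (Coalgebra.comul h)
  rw [← Q.comul_star, Coalgebra.rTensor_counit_comul, Coalgebra.lTensor_counit_comul] at this
  simpa using this

theorem antipodeInv_apply (h : Q) :
    Q.antipodeInv h = star (HopfAlgebra.antipode ℂ (star h)) := rfl

@[simp] theorem antipode_antipodeInv (h : Q) :
    HopfAlgebra.antipode ℂ (Q.antipodeInv h) = h := by
  have := Q.antipode_star (star h)
  rw [star_eq_iff_star_eq] at this
  simpa [antipodeInv_apply] using this.symm

theorem antipodeInv_star (h : Q) :
    Q.antipodeInv (star h) = star (HopfAlgebra.antipode ℂ h) := by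
  simp [antipodeInv_apply]

theorem antipode_star' (h : Q) :
    HopfAlgebra.antipode ℂ (star h) = star (Q.antipodeInv h) := by
  simp [antipodeInv_apply]

/-- The antipode, as an algebra map to the opposite algebra. -/
def antipodeOp : Q →ₐ[ℂ] (Q : Type u)ᵐᵒᵖ := HopfAlgebra.antipodeAlgHomOp ℂ Q

/-- The inverse of the antipode, as an algebra map to the opposite algebra. -/
def antipodeInvOp : Q →ₐ[ℂ] (Q : Type u)ᵐᵒᵖ :=
  .ofLinearMap ((MulOpposite.opLinearEquiv ℂ).toLinearMap ∘ₗ Q.antipodeInv)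
    (MulOpposite.unop_injective (by simp [antipodeInv_apply]))
    (fun x y => MulOpposite.unop_injective (by
      simp [antipodeInv_apply, HopfAlgebra.antipode_mul_antidistrib]))

variable {Q} {P : HopfStarAlg.{u}} (f : P ⟶ Q)

theorem app_antipode (x : P) :
    app f (HopfAlgebra.antipode ℂ x) = HopfAlgebra.antipode ℂ (app f x) :=
  BialgHom.map_antipode f.toBialgHom x

theorem app_star (x : P) : app f (star x) = star (app f x) := f.map_star x

theorem app_antipodeInv (x : P) : app f (P.antipodeInv x) = Q.antipodeInv (app f x) := by
  simp [antipodeInv_apply, app_star, app_antipode]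

end HopfStarAlg

/-! ### Matrix coefficients -/

/-- Indices for the matrix coefficients of the actions of Hopf `*`-algebras. -/
inductive CoeffIndex : Type
  | unit : CoeffIndex
  | base : CoeffIndex
  | node (a b : CoeffIndex) : CoeffIndex
  | op (a : CoeffIndex) : CoeffIndex
  | inv (a : CoeffIndex) : CoeffIndex

namespace CoeffIndex

/-- The index whose coefficient at `h` determines the coefficient of a given index at `h*`. -/
def conj : CoeffIndex → CoeffIndex
  | unit => unit
  -- An element `h*` acts as the conjugate of `S⁻¹(h)`; moreover `S(h*) = S⁻¹(h)*` and `S⁻¹(h*) =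
  -- S(h)*`, so `op` and `inv` are exchanged. This is why indices for `S⁻¹` are included.
  | base => inv base
  | node a b => node a.conj b.conj
  | op a => inv a.conj
  | inv a => op a.conj

end CoeffIndex

section Coeff

variable (M : Type u) [Ring M] [Algebra ℂ M] [StarRing M]

/-- The algebras in which the matrix coefficients take their values. -/
def coeffAlg : CoeffIndex → AlgCat.{u} ℂ
  -- `ULift` puts `ℂ` in the universe of `M`, where all the other coefficient algebras live.
  | .unit => .of ℂ (ULift ℂ)
  | .base => .of ℂ (Module.End ℂ M)
  | .node a b => .of ℂ (coeffAlg a ⊗[ℂ] coeffAlg b)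
  -- The antipode reverses products; passing to opposite algebras keeps every coefficient an algebra
  -- map.
  | .op a => .of ℂ (coeffAlg a)ᵐᵒᵖ
  | .inv a => .of ℂ (coeffAlg a)ᵐᵒᵖ

section Hom

variable {M}
variable {N : Type u} [Ring N] [Algebra ℂ N] [StarRing N] {i : N →⋆ₐ[ℂ] M}

namespace GaloisCat

/-- The matrix coefficients of the action of an object of `C(N ⊂ M)`. -/
def coeff (Q : GaloisCat i) : (a : CoeffIndex) → Q.hopf →ₐ[ℂ] coeffAlg M a
  | .unit => (ULift.algEquiv (R := ℂ) (A := ℂ)).symm.toAlgHom.comp (Bialgebra.counitAlgHom ℂ Q.hopf)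
  | .base => Q.action.act
  | .node a b => (Algebra.TensorProduct.map (Q.coeff a) (Q.coeff b)).comp
      (Bialgebra.comulAlgHom ℂ Q.hopf)
  | .op a => (AlgHom.op (Q.coeff a)).comp Q.hopf.antipodeOp
  | .inv a => (AlgHom.op (Q.coeff a)).comp Q.hopf.antipodeInvOp

/-- Coefficients are built only from `ε`, `Δ`, `S`, `S⁻¹` and the action, all of which a morphism
respects. This is the source of uniqueness for maps into the universal object. -/
theorem coeff_hom {P Q : GaloisCat i} (f : P ⟶ Q) (a : CoeffIndex) (h : P.hopf) :
    Q.coeff a (HopfStarAlg.app f.hom h) = P.coeff a h := by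
  induction a generalizing h with
  | unit => exact ULift.ext _ _ (CoalgHomClass.counit_comp_apply f.hom.toBialgHom h)
  | base => exact f.comm h
  | node a b iha ihb =>
    change TensorProduct.map (Q.coeff a).toLinearMap (Q.coeff b).toLinearMap
        (Coalgebra.comul (f.hom.toBialgHom h)) =
      TensorProduct.map (P.coeff a).toLinearMap (P.coeff b).toLinearMap (Coalgebra.comul h)
    rw [← CoalgHomClass.map_comp_comul_apply]
    generalize Coalgebra.comul (R := ℂ) h = t
    induction t with
    | zero => simp
    | tmul x y => exact congrArg₂ (· ⊗ₜ[ℂ] ·) (iha x) (ihb y)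
    | add s t hs ht => simp only [map_add, hs, ht]
  | op a ih =>
    change MulOpposite.op (Q.coeff a (HopfAlgebra.antipode ℂ (HopfStarAlg.app f.hom h))) =
      MulOpposite.op (P.coeff a (HopfAlgebra.antipode ℂ h))
    rw [← HopfStarAlg.app_antipode, ih]
  | inv a ih =>
    change MulOpposite.op (Q.coeff a (Q.hopf.antipodeInv (HopfStarAlg.app f.hom h))) =
      MulOpposite.op (P.coeff a (P.hopf.antipodeInv h))
    rw [← HopfStarAlg.app_antipodeInv, ih]

end GaloisCat

end Hom

/-! ### Conjugation of coefficients -/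

variable [StarModule ℂ M]

/-- The conjugate `x ↦ (f x*)*` of an endomorphism. -/
def endConj : Module.End ℂ M →ₗ⋆[ℂ] Module.End ℂ M where
  toFun f := (starLinearEquiv ℂ (A := M)).toLinearMap ∘ₛₗ f ∘ₛₗ (starLinearEquiv ℂ (A := M)).toLinearMap
  map_add' f g := by ext; simp
  map_smul' c f := by ext; simp

variable {M} in
@[simp] theorem endConj_apply (f : Module.End ℂ M) (x : M) :
    endConj M f x = star (f (star x)) := rfl

theorem endConj_mul (f g : Module.End ℂ M) : endConj M (f * g) = endConj M f * endConj M g := by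
  ext; simp

/-- The map relating the coefficients at `h*` to those at `h`. -/
def coeffConj : (a : CoeffIndex) → coeffAlg M a.conj →ₗ⋆[ℂ] coeffAlg M a
  | .unit =>
    { toFun := fun x : ULift ℂ => (⟨star x.down⟩ : ULift ℂ)
      map_add' := fun x y => ULift.ext _ _ (star_add x.down y.down)
      map_smul' := fun c x => ULift.ext _ _ (star_mul' c x.down) }
  | .base => (endConj M).comp (MulOpposite.opLinearEquiv ℂ (M := Module.End ℂ M)).symm.toLinearMap
  | .node a b => TensorProduct.map (coeffConj a) (coeffConj b)
  | .op a => (MulOpposite.opLinearEquiv ℂ (M := coeffAlg M a)).toLinearMap.comp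
      ((coeffConj a).comp (MulOpposite.opLinearEquiv ℂ (M := coeffAlg M a.conj)).symm.toLinearMap)
  | .inv a => (MulOpposite.opLinearEquiv ℂ (M := coeffAlg M a)).toLinearMap.comp
      ((coeffConj a).comp (MulOpposite.opLinearEquiv ℂ (M := coeffAlg M a.conj)).symm.toLinearMap)

/-- Conjugation on `End M` itself preserves the order of products; the reversal at `base` comes from
the source, the algebra at `inv base`, being opposite. The other indices follow by induction. -/
theorem coeffConj_mul (a : CoeffIndex) (x y : coeffAlg M a.conj) :
    coeffConj M a (x * y) = coeffConj M a y * coeffConj M a x := by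
  induction a with
  | unit => exact ULift.ext _ _ (star_mul x.down y.down)
  | base => exact endConj_mul M _ _
  | node a b iha ihb =>
    change coeffAlg M a.conj ⊗[ℂ] coeffAlg M b.conj at x y
    change TensorProduct.map (coeffConj M a) (coeffConj M b) (x * y) =
      TensorProduct.map (coeffConj M a) (coeffConj M b) y *
      TensorProduct.map (coeffConj M a) (coeffConj M b) x
    induction x with
    | zero => simp
    | add x x' hx hx' => simp only [map_add, add_mul, mul_add, hx, hx']
    | tmul x x' =>
      induction y with
      | zero => simp
      | add y y' hy hy' => simp only [map_add, add_mul, mul_add, hy, hy']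
      | tmul y y' => simp [iha, ihb]
  | op a ih =>
    exact congrArg MulOpposite.op (ih _ _)
  | inv a ih =>
    exact congrArg MulOpposite.op (ih _ _)

theorem coeffConj_one (a : CoeffIndex) : coeffConj M a 1 = 1 := by
  induction a with
  | unit => exact ULift.ext _ _ (star_one ℂ)
  | base =>
    change endConj M 1 = 1
    ext; simp
  | node a b iha ihb =>
    exact congrArg₂ (· ⊗ₜ[ℂ] ·) iha ihb
  | op a ih => exact congrArg MulOpposite.op ih
  | inv a ih => exact congrArg MulOpposite.op ih

variable {M}
variable {N : Type u} [Ring N] [Algebra ℂ N] [StarRing N] {i : N →⋆ₐ[ℂ] M}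

namespace GaloisCat

/-- The coefficients at `h*` are functions of those at `h` that do not depend on `Q`, so the
involution can be defined on families of coefficients. The base case is `star_act` applied to
`S⁻¹(h)`. -/
theorem coeff_star (Q : GaloisCat i) (a : CoeffIndex) (h : Q.hopf) :
    Q.coeff a (star h) = coeffConj M a (Q.coeff a.conj h) := by
  induction a generalizing h with
  | unit => exact ULift.ext _ _ (Q.hopf.counit_star h)
  | base =>
    change Q.action.act (star h) = endConj M (Q.action.act (Q.hopf.antipodeInv h))
    ext x
    rw [endConj_apply, Q.action.star_act, star_star, Q.hopf.antipode_antipodeInv]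
  | node a b iha ihb =>
    change TensorProduct.map (Q.coeff a).toLinearMap (Q.coeff b).toLinearMap
        (Coalgebra.comul (star h)) =
      TensorProduct.map (coeffConj M a) (coeffConj M b)
        (TensorProduct.map (Q.coeff a.conj).toLinearMap (Q.coeff b.conj).toLinearMap
          (Coalgebra.comul h))
    rw [Q.hopf.comul_star]
    generalize Coalgebra.comul (R := ℂ) h = t
    induction t with
    | zero => simp
    | tmul x y => simp [iha, ihb]
    | add s t hs ht => simp only [star_add, map_add, hs, ht]
  | op a ih =>
    change MulOpposite.op (Q.coeff a (HopfAlgebra.antipode ℂ (star h))) =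
      MulOpposite.op (coeffConj M a (Q.coeff a.conj (Q.hopf.antipodeInv h)))
    rw [Q.hopf.antipode_star', ih]
  | inv a ih =>
    change MulOpposite.op (Q.coeff a (Q.hopf.antipodeInv (star h))) =
      MulOpposite.op (coeffConj M a (Q.coeff a.conj (HopfAlgebra.antipode ℂ h)))
    rw [Q.hopf.antipodeInv_star, ih]

end GaloisCat

end Coeff

/-! ### The universal Hopf `*`-algebra of a class of objects -/

section Universal

variable {M : Type u} [Ring M] [Algebra ℂ M] [StarRing M]
  {N : Type u} [Ring N] [Algebra ℂ N] [StarRing N] {i : N →⋆ₐ[ℂ] M}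
  (P : ObjectProperty (GaloisCat i))

/-- The algebra generated by the families of matrix coefficients of all objects of `C(N ⊂ M)`
with a given property. -/
def coeffSubalgebra : Subalgebra ℂ (∀ a, coeffAlg M a) :=
  Algebra.adjoin ℂ {e | ∃ Q : GaloisCat i, P Q ∧ ∃ h : Q.hopf, (fun a => Q.coeff a h) = e}

/-- The algebra `coeffSubalgebra`, as a type. -/
def UnivAlg : Type u := coeffSubalgebra P

namespace UnivAlg

instance : Ring (UnivAlg P) := inferInstanceAs (Ring (coeffSubalgebra P))
instance : Algebra ℂ (UnivAlg P) := inferInstanceAs (Algebra ℂ (coeffSubalgebra P))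

/-- The coefficients of the elements of `UnivAlg P`. -/
def coeff (a : CoeffIndex) : UnivAlg P →ₐ[ℂ] coeffAlg M a :=
  (Pi.evalAlgHom ℂ (fun a => coeffAlg M a) a).comp (coeffSubalgebra P).val

/-- The canonical map from an object of `C(N ⊂ M)`. -/
def of {Q : GaloisCat i} (hQ : P Q) : Q.hopf →ₐ[ℂ] UnivAlg P :=
  (AlgHom.pi Q.coeff).codRestrict (coeffSubalgebra P)
    fun h => Algebra.subset_adjoin ⟨Q, hQ, h, rfl⟩

variable {P}

theorem ext {x y : UnivAlg P} (h : ∀ a, coeff P a x = coeff P a y) : x = y :=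
  Subtype.ext (funext h)

theorem algHom_ext {B : Type*} [Semiring B] [Algebra ℂ B] {f g : UnivAlg P →ₐ[ℂ] B}
    (h : ∀ (Q : GaloisCat i) (hQ : P Q) (x : Q.hopf), f (of P hQ x) = g (of P hQ x)) : f = g :=
  AlgHom.adjoin_ext (φ₁ := f) (φ₂ := g) (by rintro _ ⟨Q, hQ, x, rfl⟩; exact h Q hQ x)

@[elab_as_elim]
theorem induction {p : UnivAlg P → Prop} (x : UnivAlg P)
    (of : ∀ (Q : GaloisCat i) (hQ : P Q) (h : Q.hopf), p (of P hQ h))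
    (algebraMap : ∀ c : ℂ, p (algebraMap ℂ _ c))
    (add : ∀ x y, p x → p y → p (x + y)) (mul : ∀ x y, p x → p y → p (x * y)) : p x := by
  obtain ⟨x, hx⟩ := x
  induction hx using Algebra.adjoin_induction with
  | mem x hx =>
    obtain ⟨Q, hQ, h, rfl⟩ := hx
    exact of Q hQ h
  | algebraMap c => exact algebraMap c
  | add x y hx hy h h' => exact add _ _ h h'
  | mul x y hx hy h h' => exact mul _ _ h h'

variable (P)

/-! #### The comultiplication -/

/-- The coefficients of the elements of `UnivAlg P ⊗ UnivAlg P`. -/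
def tensorCoeff : UnivAlg P ⊗[ℂ] UnivAlg P →ₐ[ℂ]
    ∀ ab : CoeffIndex × CoeffIndex, coeffAlg M ab.1 ⊗[ℂ] coeffAlg M ab.2 :=
  AlgHom.pi fun ab => Algebra.TensorProduct.map (coeff P ab.1) (coeff P ab.2)

/-- An element of `UnivAlg P` is its family of coefficients, so these are jointly injective on each
tensor factor. -/
theorem tensorCoeff_injective : Function.Injective (tensorCoeff P) := by
  rw [injective_iff_map_eq_zero]
  intro t ht
  have h0 : ∀ x : UnivAlg P, (∀ a, (coeff P a).toLinearMap x = 0) → x = 0 := fun x hx =>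
    ext fun a => by rw [map_zero]; exact hx a
  exact TensorProduct.eq_zero_of_map _ h0 _ h0 t fun a b => congrFun ht (a, b)

/-- The family of coefficients of the coproduct. -/
def comulCoeff : UnivAlg P →ₐ[ℂ]
    ∀ ab : CoeffIndex × CoeffIndex, coeffAlg M ab.1 ⊗[ℂ] coeffAlg M ab.2 :=
  AlgHom.pi fun ab => coeff P (.node ab.1 ab.2)

variable {P} in
theorem comulCoeff_of {Q : GaloisCat i} (hQ : P Q) (h : Q.hopf) :
    comulCoeff P (of P hQ h) =
      tensorCoeff P (TensorProduct.map (of P hQ).toLinearMap (of P hQ).toLinearMap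
        (Coalgebra.comul h)) := by
  funext ab
  change TensorProduct.map (Q.coeff ab.1).toLinearMap (Q.coeff ab.2).toLinearMap
      (Coalgebra.comul h) = TensorProduct.map (coeff P ab.1).toLinearMap (coeff P ab.2).toLinearMap
      (TensorProduct.map (of P hQ).toLinearMap (of P hQ).toLinearMap (Coalgebra.comul h))
  rw [TensorProduct.map_map]
  rfl

/-- `comulCoeff P` is an algebra map and the range is a subalgebra, so only the generators matter;
there the coproduct of `Q` supplies a preimage. -/
theorem comulCoeff_mem (x : UnivAlg P) : comulCoeff P x ∈ (tensorCoeff P).range := by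
  induction x using induction with
  | of Q hQ h => exact ⟨_, (comulCoeff_of hQ h).symm⟩
  | algebraMap c => rw [AlgHom.commutes]; exact Subalgebra.algebraMap_mem _ c
  | add x y hx hy => rw [map_add]; exact add_mem hx hy
  | mul x y hx hy => rw [map_mul]; exact mul_mem hx hy

/-- The comultiplication. -/
def comul : UnivAlg P →ₐ[ℂ] UnivAlg P ⊗[ℂ] UnivAlg P :=
  (AlgEquiv.ofInjective (tensorCoeff P) (tensorCoeff_injective P)).symm.toAlgHom.comp
    ((comulCoeff P).codRestrict _ (comulCoeff_mem P))

theorem tensorCoeff_comul (x : UnivAlg P) : tensorCoeff P (comul P x) = comulCoeff P x := by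
  have h := (AlgEquiv.ofInjective (tensorCoeff P) (tensorCoeff_injective P)).apply_symm_apply
    ((comulCoeff P).codRestrict _ (comulCoeff_mem P) x)
  exact congrArg Subtype.val h

variable {P} in
theorem comul_of {Q : GaloisCat i} (hQ : P Q) (h : Q.hopf) :
    comul P (of P hQ h) = TensorProduct.map (of P hQ).toLinearMap (of P hQ).toLinearMap
        (Coalgebra.comul h) :=
  tensorCoeff_injective P (by rw [tensorCoeff_comul, comulCoeff_of])

/-- The counit. -/
def counit : UnivAlg P →ₐ[ℂ] ℂ :=
  (ULift.algEquiv (R := ℂ) (A := ℂ)).toAlgHom.comp (coeff P .unit)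

variable {P} in
@[simp] theorem counit_of {Q : GaloisCat i} (hQ : P Q) (h : Q.hopf) :
    counit P (of P hQ h) = Coalgebra.counit (R := ℂ) h := rfl

variable {P} in
theorem map_comul_of {Q : GaloisCat i} (hQ : P Q) (t : Q.hopf ⊗[ℂ] Q.hopf) :
    Algebra.TensorProduct.map (comul P) (.id ℂ (UnivAlg P))
      (TensorProduct.map (of P hQ).toLinearMap (of P hQ).toLinearMap t) =
    TensorProduct.map (TensorProduct.map (of P hQ).toLinearMap (of P hQ).toLinearMap)
      (of P hQ).toLinearMap (Coalgebra.comul.rTensor _ t) := by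
  induction t with
  | zero => simp
  | tmul x y => simp [comul_of]
  | add s t hs ht => simp only [map_add, hs, ht]

variable {P} in
theorem map_id_comul_of {Q : GaloisCat i} (hQ : P Q) (t : Q.hopf ⊗[ℂ] Q.hopf) :
    Algebra.TensorProduct.map (.id ℂ (UnivAlg P)) (comul P)
      (TensorProduct.map (of P hQ).toLinearMap (of P hQ).toLinearMap t) =
    TensorProduct.map (of P hQ).toLinearMap
      (TensorProduct.map (of P hQ).toLinearMap (of P hQ).toLinearMap)
      (Coalgebra.comul.lTensor _ t) := by
  induction t with
  | zero => simp
  | tmul x y => simp [comul_of]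
  | add s t hs ht => simp only [map_add, hs, ht]

/-- Coassociativity and the counit laws are equalities of algebra maps, hence follow from those of
the generating objects. -/
instance : Bialgebra ℂ (UnivAlg P) :=
  Bialgebra.ofAlgHom (comul P) (counit P)
    (algHom_ext fun Q hQ h => by
      change TensorProduct.assoc ℂ _ _ _ (Algebra.TensorProduct.map (comul P) (.id ℂ _)
        (comul P (of P hQ h))) = Algebra.TensorProduct.map (.id ℂ _) (comul P)
        (comul P (of P hQ h))
      rw [comul_of, map_comul_of, map_id_comul_of, ← Coalgebra.coassoc_apply,
        TensorProduct.map_map_assoc])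
    (algHom_ext fun Q hQ h => by
      have key : ∀ t : Q.hopf ⊗[ℂ] Q.hopf,
          Algebra.TensorProduct.map (counit P) (.id ℂ (UnivAlg P))
            (TensorProduct.map (of P hQ).toLinearMap (of P hQ).toLinearMap t) =
          LinearMap.lTensor ℂ (of P hQ).toLinearMap (Coalgebra.counit.rTensor _ t) := fun t => by
        induction t with
        | zero => simp
        | tmul x y => simp
        | add s t hs ht => simp only [map_add, hs, ht]
      change Algebra.TensorProduct.map (counit P) (.id ℂ (UnivAlg P)) (comul P (of P hQ h)) =
        1 ⊗ₜ of P hQ h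
      rw [comul_of, key, Coalgebra.rTensor_counit_comul]
      rfl)
    (algHom_ext fun Q hQ h => by
      have key : ∀ t : Q.hopf ⊗[ℂ] Q.hopf,
          Algebra.TensorProduct.map (.id ℂ (UnivAlg P)) (counit P)
            (TensorProduct.map (of P hQ).toLinearMap (of P hQ).toLinearMap t) =
          LinearMap.rTensor ℂ (of P hQ).toLinearMap (Coalgebra.counit.lTensor _ t) := fun t => by
        induction t with
        | zero => simp
        | tmul x y => simp
        | add s t hs ht => simp only [map_add, hs, ht]
      change Algebra.TensorProduct.map (.id ℂ (UnivAlg P)) (counit P) (comul P (of P hQ h)) =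
        of P hQ h ⊗ₜ 1
      rw [comul_of, key, Coalgebra.lTensor_counit_comul]
      rfl)

/-! #### The antipode -/

/-- The antipode on families of coefficients. -/
def antipodeCoeff : (∀ a, coeffAlg M a) →ₗ[ℂ] ∀ a, coeffAlg M a :=
  LinearMap.pi fun a => (MulOpposite.opLinearEquiv ℂ (M := coeffAlg M a)).symm.toLinearMap ∘ₗ
    LinearMap.proj (CoeffIndex.op a)

theorem antipodeCoeff_mem (x : UnivAlg P) : antipodeCoeff x.1 ∈ coeffSubalgebra P := by
  induction x using induction with
  | of Q hQ h => exact (of P hQ (HopfAlgebra.antipode ℂ h)).2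
  | algebraMap c => exact (algebraMap ℂ (UnivAlg P) c).2
  | add x y hx hy =>
    exact (congrArg (· ∈ coeffSubalgebra P) (map_add antipodeCoeff x.1 y.1)).mpr (add_mem hx hy)
  | mul x y hx hy => exact mul_mem hy hx

/-- The antipode. -/
def antipode : UnivAlg P →ₗ[ℂ] UnivAlg P where
  toFun x := ⟨antipodeCoeff x.1, antipodeCoeff_mem P x⟩
  map_add' x y := Subtype.ext (map_add antipodeCoeff x.1 y.1)
  map_smul' c x := Subtype.ext (map_smul antipodeCoeff c x.1)

variable {P} in
theorem antipode_of {Q : GaloisCat i} (hQ : P Q) (h : Q.hopf) :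
    antipode P (of P hQ h) = of P hQ (HopfAlgebra.antipode ℂ h) := rfl

/-- True by definition, because the coefficient at `op a` takes values in the opposite algebra. -/
theorem antipode_mul (x y : UnivAlg P) : antipode P (x * y) = antipode P y * antipode P x := rfl

theorem antipode_algebraMap (c : ℂ) : antipode P (algebraMap ℂ _ c) = algebraMap ℂ _ c := rfl

/-- For `u = ∑ a ⊗ b` and `v = x ⊗ y` the left side is `∑ S(x) S(a) b y`, whose inner part is the
scalar `c`. The antipode axiom is not an equality of algebra maps, and this is what carries it from
two elements to their product. -/
theorem mul_map_antipode_left_mul (u v : UnivAlg P ⊗[ℂ] UnivAlg P) (c : ℂ)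
    (hu : LinearMap.mul' ℂ _ ((antipode P).rTensor _ u) = algebraMap ℂ _ c) :
    LinearMap.mul' ℂ _ ((antipode P).rTensor _ (u * v)) =
      c • LinearMap.mul' ℂ _ ((antipode P).rTensor _ v) := by
  induction v with
  | zero => simp
  | add s t hs ht => simp only [mul_add, map_add, smul_add, hs, ht]
  | tmul x y =>
    have key : LinearMap.mul' ℂ _ ((antipode P).rTensor _ (u * x ⊗ₜ y)) =
        antipode P x * LinearMap.mul' ℂ _ ((antipode P).rTensor _ u) * y := by
      clear hu
      induction u with
      | zero => simp
      | add s t hs ht => simp only [add_mul, mul_add, map_add, hs, ht]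
      | tmul a b => simp [antipode_mul, mul_assoc]
    rw [key, hu, ← Algebra.commutes, Algebra.algebraMap_eq_smul_one]
    simp

/-- Mirror image: for `u = x ⊗ y` and `v = ∑ a ⊗ b` the scalar is the inner part of `∑ x a S(b)
S(y)`. -/
theorem mul_map_antipode_right_mul (u v : UnivAlg P ⊗[ℂ] UnivAlg P) (c : ℂ)
    (hv : LinearMap.mul' ℂ _ ((antipode P).lTensor _ v) = algebraMap ℂ _ c) :
    LinearMap.mul' ℂ _ ((antipode P).lTensor _ (u * v)) =
      c • LinearMap.mul' ℂ _ ((antipode P).lTensor _ u) := by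
  induction u with
  | zero => simp
  | add s t hs ht => simp only [add_mul, map_add, smul_add, hs, ht]
  | tmul x y =>
    have key : LinearMap.mul' ℂ _ ((antipode P).lTensor _ (x ⊗ₜ y * v)) =
        x * LinearMap.mul' ℂ _ ((antipode P).lTensor _ v) * antipode P y := by
      clear hv
      induction v with
      | zero => simp
      | add s t hs ht => simp only [add_mul, mul_add, map_add, hs, ht]
      | tmul a b => simp [antipode_mul, mul_assoc]
    rw [key, hv, ← Algebra.commutes, Algebra.algebraMap_eq_smul_one]
    simp

instance : HopfAlgebra ℂ (UnivAlg P) where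
  antipode := antipode P
  mul_antipode_rTensor_comul := by
    ext x
    change LinearMap.mul' ℂ _ ((antipode P).rTensor _ (comul P x)) = algebraMap ℂ _ (counit P x)
    induction x using induction with
    | of Q hQ h =>
      have key : ∀ t : Q.hopf ⊗[ℂ] Q.hopf, LinearMap.mul' ℂ _ ((antipode P).rTensor _
          (TensorProduct.map (of P hQ).toLinearMap (of P hQ).toLinearMap t)) =
          of P hQ (LinearMap.mul' ℂ _ ((HopfAlgebra.antipode ℂ).rTensor _ t)) := fun t => by
        induction t with
        | zero => simp
        | tmul x y => simp [antipode_of]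
        | add s t hs ht => simp only [map_add, hs, ht]
      rw [comul_of, key, HopfAlgebra.mul_antipode_rTensor_comul_apply, AlgHom.commutes, counit_of]
    | algebraMap c =>
      rw [AlgHom.commutes, AlgHom.commutes, Algebra.TensorProduct.algebraMap_apply]
      simp [antipode_algebraMap]
    | add x y hx hy => simp only [map_add, hx, hy]
    | mul x y hx hy =>
      rw [map_mul, mul_map_antipode_left_mul P _ _ _ hx, hy, map_mul, map_mul, Algebra.smul_def]
  mul_antipode_lTensor_comul := by
    ext x
    change LinearMap.mul' ℂ _ ((antipode P).lTensor _ (comul P x)) = algebraMap ℂ _ (counit P x)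
    induction x using induction with
    | of Q hQ h =>
      have key : ∀ t : Q.hopf ⊗[ℂ] Q.hopf, LinearMap.mul' ℂ _ ((antipode P).lTensor _
          (TensorProduct.map (of P hQ).toLinearMap (of P hQ).toLinearMap t)) =
          of P hQ (LinearMap.mul' ℂ _ ((HopfAlgebra.antipode ℂ).lTensor _ t)) := fun t => by
        induction t with
        | zero => simp
        | tmul x y => simp [antipode_of]
        | add s t hs ht => simp only [map_add, hs, ht]
      rw [comul_of, key, HopfAlgebra.mul_antipode_lTensor_comul_apply, AlgHom.commutes, counit_of]
    | algebraMap c =>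
      rw [AlgHom.commutes, AlgHom.commutes, Algebra.TensorProduct.algebraMap_apply]
      have h1 : antipode P 1 = 1 := by simpa using antipode_algebraMap P 1
      simp [h1]
    | add x y hx hy => simp only [map_add, hx, hy]
    | mul x y hx hy =>
      rw [map_mul, mul_map_antipode_right_mul P _ _ _ hy, hx, map_mul, mul_comm (counit P x),
        map_mul, Algebra.smul_def]

/-! #### The action -/

/-- The action of `UnivAlg P` on `M`. -/
def act : UnivAlg P →ₐ[ℂ] Module.End ℂ M := coeff P .base

variable {P} in
theorem act_of {Q : GaloisCat i} (hQ : P Q) (h : Q.hopf) :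
    act P (of P hQ h) = Q.action.act h := rfl

/-- `x ⊗ y ↦ (h₁ · x) (h₂ · y)` for `t = ∑ h₁ ⊗ h₂`. -/
def mulAct (t : UnivAlg P ⊗[ℂ] UnivAlg P) (x y : M) : M :=
  LinearMap.mul' ℂ M (TensorProduct.map ((act P).toLinearMap.flip x)
    ((act P).toLinearMap.flip y) t)

/-- Used with `u = Δ(h)` and `v = Δ(k)`: the module algebra identity for `h` and `k` then passes to
`hk`. -/
theorem mulAct_mul (h : UnivAlg P) (u v : UnivAlg P ⊗[ℂ] UnivAlg P)
    (hu : ∀ x y, act P h (x * y) = mulAct P u x y) (x y : M) :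
    act P h (mulAct P v x y) = mulAct P (u * v) x y := by
  induction v with
  | zero => simp [mulAct]
  | add s t hs ht =>
    simp only [mulAct, mul_add, map_add] at hs ht ⊢
    rw [hs, ht]
  | tmul c d =>
    have : mulAct P (c ⊗ₜ d) x y = act P c x * act P d y := by simp [mulAct]
    rw [this, hu]
    clear hu
    induction u with
    | zero => simp [mulAct]
    | add s t hs ht =>
      simp only [mulAct, add_mul, map_add] at hs ht ⊢
      rw [hs, ht]
    | tmul a b => simp [mulAct]

theorem act_mul (h : UnivAlg P) (x y : M) : act P h (x * y) = mulAct P (comul P h) x y := by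
  induction h using induction generalizing x y with
  | of Q hQ h =>
    rw [act_of, Q.action.act_mul, mulAct, comul_of, TensorProduct.map_map]
    rfl
  | algebraMap c =>
    rw [AlgHom.commutes, AlgHom.commutes, Algebra.TensorProduct.algebraMap_apply]
    simp [mulAct, Module.algebraMap_end_apply]
  | add h k hh hk => simp [mulAct, hh, hk]
  | mul h k hh hk =>
    rw [map_mul (act P), map_mul (comul P), Module.End.mul_apply, hk, mulAct_mul P h _ _ hh]

/-! #### The involution -/

variable [StarModule ℂ M]

/-- The involution on families of coefficients. -/
def starCoeff : (∀ a, coeffAlg M a) →ₗ⋆[ℂ] ∀ a, coeffAlg M a where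
  toFun e a := coeffConj M a (e a.conj)
  map_add' _ _ := funext fun a => map_add (coeffConj M a) _ _
  map_smul' _ _ := funext fun a => map_smulₛₗ (coeffConj M a) _ _

theorem starCoeff_mul (e f : ∀ a, coeffAlg M a) :
    starCoeff (e * f) = starCoeff f * starCoeff e := funext fun a => coeffConj_mul M a _ _

theorem starCoeff_algebraMap (c : ℂ) :
    starCoeff (algebraMap ℂ (∀ a, coeffAlg M a) c) = algebraMap ℂ _ (star c) := by
  rw [Algebra.algebraMap_eq_smul_one, Algebra.algebraMap_eq_smul_one, map_smulₛₗ]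
  exact congrArg _ (funext fun a => coeffConj_one M a)

theorem starCoeff_of (Q : GaloisCat i) (h : Q.hopf) :
    starCoeff (fun a => Q.coeff a h) = fun a => Q.coeff a (star h) :=
  funext fun a => (Q.coeff_star a h).symm

theorem starCoeff_mem (x : UnivAlg P) : starCoeff x.1 ∈ coeffSubalgebra P := by
  induction x using induction with
  | of Q hQ h =>
    exact (congrArg (· ∈ coeffSubalgebra P) (starCoeff_of Q h)).mpr (of P hQ (star h)).2
  | algebraMap c =>
    exact (congrArg (· ∈ coeffSubalgebra P) (starCoeff_algebraMap c)).mpr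
      (algebraMap ℂ (UnivAlg P) (star c)).2
  | add x y hx hy =>
    exact (congrArg (· ∈ coeffSubalgebra P) (map_add starCoeff x.1 y.1)).mpr (add_mem hx hy)
  | mul x y hx hy =>
    exact (congrArg (· ∈ coeffSubalgebra P) (starCoeff_mul x.1 y.1)).mpr (mul_mem hy hx)

instance : Star (UnivAlg P) := ⟨fun x => ⟨starCoeff x.1, starCoeff_mem P x⟩⟩

variable {P} in
theorem star_of {Q : GaloisCat i} (hQ : P Q) (h : Q.hopf) :
    star (of P hQ h) = of P hQ (star h) := Subtype.ext (starCoeff_of Q h)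

theorem star_mul_eq (x y : UnivAlg P) : star (x * y) = star y * star x :=
  Subtype.ext (starCoeff_mul x.1 y.1)

theorem star_add_eq (x y : UnivAlg P) : star (x + y) = star x + star y :=
  Subtype.ext (map_add starCoeff x.1 y.1)

theorem star_algebraMap_eq (c : ℂ) :
    star (algebraMap ℂ (UnivAlg P) c) = algebraMap ℂ _ (star c) :=
  Subtype.ext (starCoeff_algebraMap c)

instance : StarRing (UnivAlg P) where
  -- Checking on generators avoids identifying the coefficient algebras at `a.conj.conj` and `a`.
  star_involutive x := by
    induction x using induction with
    | of Q hQ h => rw [star_of, star_of, star_star]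
    | algebraMap c => rw [star_algebraMap_eq, star_algebraMap_eq, star_star]
    | add x y hx hy => rw [star_add_eq, star_add_eq, hx, hy]
    | mul x y hx hy => rw [star_mul_eq, star_mul_eq, hx, hy]
  star_mul := star_mul_eq P
  star_add := star_add_eq P

instance : StarModule ℂ (UnivAlg P) where
  star_smul c x := Subtype.ext (map_smulₛₗ starCoeff c x.1)

/-- The Hopf `*`-algebra `UnivAlg P`. -/
def hopf : HopfStarAlg.{u} where
  carrier := UnivAlg P
  comul_star x := by
    change comul P (star x) = star (comul P x)
    induction x using induction with
    | of Q hQ h =>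
      rw [star_of, comul_of, comul_of, Q.hopf.comul_star]
      generalize Coalgebra.comul (R := ℂ) h = t
      induction t with
      | zero => simp
      | tmul x y => simp [star_of]
      | add s t hs ht => simp only [star_add, map_add, hs, ht]
    | algebraMap c =>
      rw [star_algebraMap_eq, AlgHom.commutes, AlgHom.commutes, algebraMap_star_comm]
    | add x y hx hy => simp only [star_add, map_add, hx, hy]
    | mul x y hx hy => simp only [star_mul, map_mul, hx, hy]
  antipode_star x := by
    change star (antipode P (star (antipode P x))) = x
    induction x using induction with
    | of Q hQ h => rw [antipode_of, star_of, antipode_of, star_of, Q.hopf.antipode_star]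
    | algebraMap c =>
      rw [antipode_algebraMap, star_algebraMap_eq, antipode_algebraMap, star_algebraMap_eq,
        star_star]
    | add x y hx hy => simp only [star_add, map_add, hx, hy]
    | mul x y hx hy => rw [antipode_mul, star_mul, antipode_mul, star_mul, hx, hy]

/-- `M` is a module `*`-algebra over `UnivAlg P`. -/
def action : ModuleStarAction (hopf P) M where
  act := act P
  act_mul := act_mul P
  act_one h := by
    change act P h 1 = counit P h • (1 : M)
    induction h using induction with
    | of Q hQ h => exact Q.action.act_one h
    | algebraMap c => simp [Module.algebraMap_end_apply]
    | add h k hh hk => simp [hh, hk, add_smul]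
    | mul h k hh hk => simp [hh, hk, smul_smul, mul_comm]
  star_act h x := by
    change star (act P h x) = act P (star (antipode P h)) (star x)
    induction h using induction generalizing x with
    | of Q hQ h =>
      rw [antipode_of, star_of]
      exact Q.action.star_act h x
    | algebraMap c =>
      rw [antipode_algebraMap, star_algebraMap_eq]
      simp [Module.algebraMap_end_apply]
    | add h k hh hk => simp [hh, hk]
    | mul h k hh hk => simp [antipode_mul, hh, hk]

/-- The object of `C(N ⊂ M)` given by `UnivAlg P`. -/
def obj : GaloisCat i where
  hopf := hopf P
  action := action P
  fixes := by
    rintro _ ⟨n, rfl⟩ h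
    change act P h (i n) = counit P h • i n
    induction h using induction with
    | of Q hQ h => exact Q.fixes ⟨n, rfl⟩ h
    | algebraMap c => simp [Module.algebraMap_end_apply]
    | add h k hh hk => simp [hh, hk, add_smul]
    | mul h k hh hk => simp [hh, hk, smul_smul, mul_comm]

/-- The morphism from an object with the property `P`. -/
def toObj {Q : GaloisCat i} (hQ : P Q) : Q ⟶ obj P where
  hom :=
    { toBialgHom := BialgHom.ofAlgHom (of P hQ) (AlgHom.ext fun h => counit_of hQ h)
        (AlgHom.ext fun h => (comul_of hQ h).symm)
      map_star := fun h => (star_of hQ h).symm }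
  comm := fun h => act_of hQ h

/-- The coefficients of `UnivAlg P` as an acting Hopf `*`-algebra are its tautological ones: both
are algebra maps, and on generators they agree because `toObj` preserves coefficients. -/
theorem coeff_obj (a : CoeffIndex) (x : UnivAlg P) : (obj P).coeff a x = coeff P a x := by
  have : (obj P).coeff a = coeff P a := algHom_ext fun Q hQ h =>
    GaloisCat.coeff_hom (toObj P hQ) a h
  exact DFunLike.congr_fun this x

/-- The coefficients of `f h` and `g h` are both those of `h`, and they determine an element of
`UnivAlg P`. -/
theorem hom_obj_ext {Q : GaloisCat i} (f g : Q ⟶ obj P) : f = g :=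
  GaloisCat.Hom.ext <| HopfStarAlg.hom_ext fun h => ext fun a => by
    exact (coeff_obj P a _).symm.trans <| (GaloisCat.coeff_hom f a h).trans <|
      (GaloisCat.coeff_hom g a h).symm.trans (coeff_obj P a _)

theorem preservesFunctional_obj (τ : M →ₗ[ℂ] ℂ)
    (hP : ∀ Q, P Q → Q.action.PreservesFunctional τ) : (obj P).action.PreservesFunctional τ := by
  intro h x
  change τ (act P h x) = counit P h * τ x
  induction h using induction generalizing x with
  | of Q hQ h => exact hP Q hQ h x
  | algebraMap c => simp [Module.algebraMap_end_apply]
  | add h k hh hk => simp [hh, hk, add_mul]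
  | mul h k hh hk => simp [hh, hk, mul_assoc]

end UnivAlg
end Universal

/-! ### Actions on the algebra `M` and on the algebra object `M` -/

section Comparison

open NBimod

variable {M : Type u} [Ring M] [Algebra ℂ M] [StarRing M]
  {N : Type u} [Ring N] [Algebra ℂ N] [StarRing N] {i : N →⋆ₐ[ℂ] M}

/-- Endomorphisms of the bimodule `M`, as linear endomorphisms of `M`. -/
def endToLin (i : N →⋆ₐ[ℂ] M) : End (ofAlgHom (i : N →ₐ[ℂ] M)) →ₐ[ℂ] Module.End ℂ M :=
  .ofLinearMap
    { toFun := fun f => (lin f : M →ₗ[ℂ] M)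
      map_add' := fun _ _ => rfl
      map_smul' := fun _ _ => rfl } rfl fun _ _ => rfl

theorem endToLin_injective : Function.Injective (endToLin i) := fun _ _ h => hom_ext h

theorem endToLin_endTensor_mul
    (t : End (ofAlgHom (i : N →ₐ[ℂ] M)) ⊗[ℂ] End (ofAlgHom (i : N →ₐ[ℂ] M))) (x y : M) :
    lin (X := tensor (ofAlgHom (i : N →ₐ[ℂ] M)) (ofAlgHom (i : N →ₐ[ℂ] M)))
      (endTensor (ofAlgHom (i : N →ₐ[ℂ] M)) t ≫ algMul (i : N →ₐ[ℂ] M))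
      (tm _ _ (toBimod (i : N →ₐ[ℂ] M) x) (toBimod (i : N →ₐ[ℂ] M) y)) =
      toBimod (i : N →ₐ[ℂ] M) (LinearMap.mul' ℂ M (TensorProduct.map
        ((endToLin i).toLinearMap.flip x) ((endToLin i).toLinearMap.flip y) t)) := by
  rw [lin_comp]
  induction t with
  | zero =>
    simp only [map_zero]
    exact map_zero (lin (algMul (i : N →ₐ[ℂ] M)))
  | tmul f g =>
    change lin (algMul (i : N →ₐ[ℂ] M)) (lin (tensorMap f g)
      (tm _ _ (toBimod (i : N →ₐ[ℂ] M) x) (toBimod (i : N →ₐ[ℂ] M) y))) = _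
    rw [tensorMap_tm]
    exact algMul_tm (i : N →ₐ[ℂ] M) _ _
  | add s t hs ht =>
    simp only [map_add] at hs ht ⊢
    rw [← hs, ← ht]
    exact map_add (lin (algMul (i : N →ₐ[ℂ] M))) _ _

/-- A map out of `M ⊗_N M` is determined on the elements `x ⊗ y`. With `t` the image of `Δ(h)`, the
categorical compatibility becomes the module algebra identity. -/
theorem mul_comp_eq_iff (f : End (ofAlgHom (i : N →ₐ[ℂ] M)))
    (t : End (ofAlgHom (i : N →ₐ[ℂ] M)) ⊗[ℂ] End (ofAlgHom (i : N →ₐ[ℂ] M))) :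
    MonObj.mul ≫ f = endTensor (ofAlgHom (i : N →ₐ[ℂ] M)) t ≫ MonObj.mul ↔
      ∀ x y : M, endToLin i f (x * y) = LinearMap.mul' ℂ M (TensorProduct.map
        ((endToLin i).toLinearMap.flip x) ((endToLin i).toLinearMap.flip y) t) := by
  have hl (x y : M) : lin (X := tensor (ofAlgHom (i : N →ₐ[ℂ] M)) (ofAlgHom (i : N →ₐ[ℂ] M)))
      (algMul (i : N →ₐ[ℂ] M) ≫ f)
      (tm _ _ (toBimod (i : N →ₐ[ℂ] M) x) (toBimod (i : N →ₐ[ℂ] M) y)) =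
      toBimod (i : N →ₐ[ℂ] M) (endToLin i f (x * y)) :=
    congrArg (lin f) (algMul_tm (i : N →ₐ[ℂ] M) x y)
  constructor
  · intro h x y
    apply (toBimod (i : N →ₐ[ℂ] M)).injective
    rw [← endToLin_endTensor_mul, ← hl]
    exact congrArg (fun g => lin (X := tensor _ _) g (tm _ _ _ _)) h
  · intro h
    refine tensor_hom_ext (LinearMap.ext₂ fun x y => ?_)
    exact (hl x y).trans ((congrArg _ (h x y)).trans (endToLin_endTensor_mul t x y).symm)

/-- For `c = ε(h)` the unit axiom of a Hopf action contains both `h·1 = ε(h)1` and the invariance of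
all of `N`. -/
theorem one_comp_eq_iff (f : End (ofAlgHom (i : N →ₐ[ℂ] M))) (c : ℂ) :
    MonObj.one ≫ f = c • MonObj.one (X := ofAlgHom (i : N →ₐ[ℂ] M)) ↔
      ∀ a : N, endToLin i f (i a) = c • i a :=
  ⟨fun h a => congrArg (fun g => lin (X := unit N) g (toUnit N a)) h,
    fun h => hom_ext (X := unit N) (LinearMap.ext h)⟩

namespace ModuleStarAction

/-- `h·(yx) = (h₁·y)(h₂·x) = y(ε(h₁)h₂·x)`. With its right-handed version, this makes an action that
fixes `N` one by bimodule maps. -/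
theorem act_fixed_mul {Q : HopfStarAlg.{u}} (α : ModuleStarAction Q M) {y : M}
    (hy : y ∈ α.invariants) (h : Q) (x : M) : α.act h (y * x) = y * α.act h x := by
  have key : ∀ t : Q ⊗[ℂ] Q, LinearMap.mul' ℂ M
      (TensorProduct.map (α.act.toLinearMap.flip y) (α.act.toLinearMap.flip x) t) =
      y * α.act (TensorProduct.lid ℂ Q (Coalgebra.counit.rTensor _ t)) x := fun t => by
    induction t with
    | zero => simp
    | tmul a b => simp [hy a]
    | add s t hs ht => simp only [map_add, hs, ht, LinearMap.add_apply, mul_add]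
  rw [α.act_mul, key, Coalgebra.rTensor_counit_comul, TensorProduct.lid_tmul, one_smul]

theorem act_mul_fixed {Q : HopfStarAlg.{u}} (α : ModuleStarAction Q M) {y : M}
    (hy : y ∈ α.invariants) (h : Q) (x : M) : α.act h (x * y) = α.act h x * y := by
  have key : ∀ t : Q ⊗[ℂ] Q, LinearMap.mul' ℂ M
      (TensorProduct.map (α.act.toLinearMap.flip x) (α.act.toLinearMap.flip y) t) =
      α.act (TensorProduct.rid ℂ Q (Coalgebra.counit.lTensor _ t)) x * y := fun t => by
    induction t with
    | zero => simp
    | tmul a b => simp [hy b]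
    | add s t hs ht => simp only [map_add, hs, ht, LinearMap.add_apply, add_mul]
  rw [α.act_mul, key, Coalgebra.lTensor_counit_comul, TensorProduct.rid_tmul, one_smul]

end ModuleStarAction

variable [StarModule ℂ M]

theorem endToLin_conj (f : End (ofAlgHom (i : N →ₐ[ℂ] M))) :
    endToLin i ((starStructure i).conj f) = endConj M (endToLin i f) := rfl

/-- The object of `C(N ⊂ M)` given by a Hopf action on the algebra object `M`. -/
def QAutCat.toGalois (R : QAutCat (ofAlgHom (i : N →ₐ[ℂ] M)) (starStructure i)) :
    GaloisCat i where
  hopf := R.hopf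
  action :=
    { act := (endToLin i).comp R.action.ρ
      act_mul := fun h x y => by
        have := (mul_comp_eq_iff _ _).1 (R.action.mul_compat h) x y
        rw [TensorProduct.map_map] at this
        exact this
      act_one := fun h => by
        have := (one_comp_eq_iff _ _).1 (R.action.one_compat h) 1
        rwa [map_one] at this
      star_act := fun h x => by
        have := congrArg (fun f => endToLin i f (star x)) (R.star_compat h)
        simp only [endToLin_conj, endConj_apply, star_star] at this
        exact this.symm }
  fixes := by
    rintro _ ⟨a, rfl⟩ h
    exact (one_comp_eq_iff _ _).1 (R.action.one_compat h) a

/-- The Hopf action on the algebra object `M` given by an object of `C(N ⊂ M)`. -/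
def GaloisCat.toQAut (Q : GaloisCat i) :
    QAutCat (ofAlgHom (i : N →ₐ[ℂ] M)) (starStructure i) :=
  let ρ : Q.hopf →ₐ[ℂ] End (ofAlgHom (i : N →ₐ[ℂ] M)) := .ofLinearMap
    { toFun := fun h => ofLin (X := ofAlgHom (i : N →ₐ[ℂ] M)) (Y := ofAlgHom (i : N →ₐ[ℂ] M))
        (Q.action.act h)
        (fun a x => Q.action.act_fixed_mul (Q.fixes ⟨a, rfl⟩) h x)
        (fun a x => Q.action.act_mul_fixed (Q.fixes ⟨a.unop, rfl⟩) h x)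
      map_add' := fun h k => hom_ext (map_add Q.action.act h k)
      map_smul' := fun c h => hom_ext (map_smul Q.action.act c h) }
    (hom_ext (map_one Q.action.act)) (fun h k => hom_ext (map_mul Q.action.act h k))
  { hopf := Q.hopf
    action :=
      { ρ := ρ
        mul_compat := fun h => by
          rw [mul_comp_eq_iff]
          intro x y
          rw [TensorProduct.map_map]
          exact Q.action.act_mul h x y
        one_compat := fun h => (one_comp_eq_iff _ _).2 fun a => Q.fixes ⟨a, rfl⟩ h }
    star_compat := fun h => endToLin_injective <| by
      rw [endToLin_conj]
      ext x
      have := Q.action.star_act h (star x)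
      rw [star_star] at this
      exact this.symm }

namespace QAutCat

variable {R S : QAutCat (ofAlgHom (i : N →ₐ[ℂ] M)) (starStructure i)}

/-- The categories of Hopf actions on the algebra `M` and on the algebra object `M` have the
same morphisms. -/
def homEquiv : (R ⟶ S) ≃ (R.toGalois ⟶ S.toGalois) where
  toFun f := ⟨f.hom, fun h => congrArg (endToLin i) (f.comm h)⟩
  invFun f := ⟨f.hom, fun h => endToLin_injective (f.comm h)⟩
  left_inv _ := rfl
  right_inv _ := rfl

end QAutCat

/-! ### Terminal objects and their transfer -/

/-- `X` has the property `P` and is terminal among the objects with this property. -/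
def IsTerminalAmong {C : Type*} [Category* C] (P : ObjectProperty C) (X : C) : Prop :=
  P X ∧ ∀ Y, P Y → Nonempty (Unique (Y ⟶ X))

namespace IsTerminalAmong

variable {C : Type*} [Category* C] {P : ObjectProperty C}

theorem iff_isTerminal_top {X : C} :
    IsTerminalAmong (⊤ : ObjectProperty C) X ↔ Nonempty (Limits.IsTerminal X) :=
  ⟨fun h => ⟨@Limits.IsTerminal.ofUnique _ _ X fun Y => (h.2 Y trivial).some⟩,
    fun ⟨h⟩ => ⟨trivial, fun Y _ => ⟨⟨⟨h.from Y⟩, fun _ => h.hom_ext _ _⟩⟩⟩⟩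

theorem iff_isTerminal {X : P.FullSubcategory} :
    IsTerminalAmong P X.obj ↔ Nonempty (Limits.IsTerminal X) :=
  ⟨fun h => ⟨@Limits.IsTerminal.ofUnique _ _ X fun Y =>
      ⟨⟨ObjectProperty.homMk (h.2 Y.obj Y.property).some.default⟩, fun f =>
        ObjectProperty.hom_ext _ ((h.2 Y.obj Y.property).some.uniq f.hom)⟩⟩,
    fun ⟨h⟩ => ⟨X.property, fun Y hY => ⟨⟨⟨(h.from ⟨Y, hY⟩).hom⟩, fun f =>
      congrArg InducedCategory.Hom.hom
        (h.hom_ext (ObjectProperty.homMk f : (⟨Y, hY⟩ : P.FullSubcategory) ⟶ X) (h.from ⟨Y, hY⟩))⟩⟩⟩⟩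

end IsTerminalAmong

theorem UnivAlg.isTerminalAmong (P : ObjectProperty (GaloisCat i)) (hP : P (UnivAlg.obj P)) :
    IsTerminalAmong P (UnivAlg.obj P) :=
  ⟨hP, fun _ hQ => ⟨⟨⟨UnivAlg.toObj P hQ⟩, fun _ => UnivAlg.hom_obj_ext P _ _⟩⟩⟩

/-- `Q.toQAut.toGalois` is `Q` by definition, so `homEquiv` identifies maps `R ⟶ Q.toQAut` with maps
`R.toGalois ⟶ Q`. -/
theorem GaloisCat.isTerminalAmong_toQAut {P : ObjectProperty (GaloisCat i)}
    {P' : ObjectProperty (QAutCat (ofAlgHom (i : N →ₐ[ℂ] M)) (starStructure i))}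
    (hP : ∀ R, P' R ↔ P R.toGalois) {Q : GaloisCat i} (hQ : IsTerminalAmong P Q) :
    IsTerminalAmong P' Q.toQAut :=
  ⟨(hP _).2 hQ.1, fun R hR =>
    ⟨@Equiv.unique _ _ (hQ.2 _ ((hP R).1 hR)).some (QAutCat.homEquiv (S := Q.toQAut))⟩⟩

/-- `Q.toQAut` has the same Hopf `*`-algebra as `Q` and is terminal alongside `R`; the unique
isomorphism between them intertwines the actions. -/
theorem IsTerminalAmong.exists_iso {P : ObjectProperty (GaloisCat i)}
    {P' : ObjectProperty (QAutCat (ofAlgHom (i : N →ₐ[ℂ] M)) (starStructure i))}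
    (hP : ∀ R, P' R ↔ P R.toGalois) {Q : GaloisCat i} (hQ : IsTerminalAmong P Q)
    {R : QAutCat (ofAlgHom (i : N →ₐ[ℂ] M)) (starStructure i)} (hR : IsTerminalAmong P' R) :
    ∃ e : Q.hopf ≅ R.hopf, ∀ h,
      R.action.ρ (HopfStarAlg.app e.hom h) = Q.toQAut.action.ρ h := by
  have hQ' := GaloisCat.isTerminalAmong_toQAut hP hQ
  obtain ⟨f⟩ := hR.2 _ hQ'.1
  obtain ⟨g⟩ := hQ'.2 _ hR.1
  obtain ⟨uQ⟩ := hQ'.2 _ hQ'.1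
  obtain ⟨uR⟩ := hR.2 _ hR.1
  refine ⟨⟨f.default.hom, g.default.hom, ?_, ?_⟩, f.default.comm⟩
  · exact congrArg QAutCat.Hom.hom ((uQ.uniq (f.default ≫ g.default)).trans (uQ.uniq (𝟙 _)).symm)
  · exact congrArg QAutCat.Hom.hom ((uR.uniq (g.default ≫ f.default)).trans (uR.uniq (𝟙 _)).symm)

end Comparison

/-! ### Trace-preserving and expectation-preserving actions -/

section Factors

variable {H : Type u} [NormedAddCommGroup H] [InnerProductSpace ℂ H] [CompleteSpace H]
  {N M : VonNeumannAlgebra H} {hNM : N ≤ M}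

/-- A Hopf action preserves the trace if and only if it preserves the trace preserving conditional
expectation. -/
theorem preserving_iff {τ : M.toStarSubalgebra →ₗ[ℂ] ℂ} (hτ : IsFaithfulNormalTrace M τ)
    {E : factorObj hNM ⟶ 𝟙_ (NBimod N.toStarSubalgebra)} (hE : IsTraceExpectation hNM τ E)
    (R : QAutCat (factorObj hNM) (factorStar hNM)) :
    QAutCat.preserving (factorStar hNM) E R ↔
      GaloisCat.preserving (factorInclusion hNM) τ R.toGalois := by
  let F : M.toStarSubalgebra →ₗ[ℂ] N.toStarSubalgebra := NBimod.lin E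
  have hF (x) : τ (factorInclusion hNM (F x)) = τ x := hE.trace x
  have hFl (a : N.toStarSubalgebra) (x) : F (factorInclusion hNM a * x) = a * F x :=
    NBimod.lin_left E a x
  have hiff : QAutCat.preserving (factorStar hNM) E R ↔ ∀ (h : R.hopf) (x : M.toStarSubalgebra),
      F (R.toGalois.action.act h x) = Coalgebra.counit (R := ℂ) h • F x :=
    ⟨fun hR h x => LinearMap.congr_fun (congrArg NBimod.lin (hR h)) x,
      fun hR h => NBimod.hom_ext (LinearMap.ext (hR h))⟩
  rw [hiff]
  constructor
  · intro hR h x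
    have := congrArg (fun y => τ (factorInclusion hNM y)) (hR h x)
    simp only [map_smul, hF, smul_eq_mul] at this
    exact this
  · intro hR h x
    -- As `E` is `N`-linear and `τ ∘ E = τ`, this is `τ(y(h·x)) = ε(h)τ(yx)`, which holds because
    -- `y(h·x) = h·(yx)` and the action preserves `τ`.
    have key (y : N.toStarSubalgebra) :
        τ (factorInclusion hNM (y * (F (R.toGalois.action.act h x) -
          Coalgebra.counit (R := ℂ) h • F x))) = 0 := by
      have h1 := (congrArg τ (R.toGalois.action.act_fixed_mul
        (R.toGalois.fixes ⟨y, rfl⟩) h x)).symm.trans (hR h (factorInclusion hNM y * x))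
      rw [← hF, hFl, ← hF (_ * x), hFl] at h1
      rw [mul_sub, map_sub, map_sub, mul_smul_comm, map_smul, map_smul, smul_eq_mul, sub_eq_zero]
      exact h1
    rw [← sub_eq_zero]
    apply (StarSubalgebra.inclusion_injective hNM)
    rw [map_zero]
    -- With `z = E(h·x) - ε(h)E(x)`, the identity `key` for `y = z*` reads `τ(z*z) = 0`.
    apply hτ.faithful
    rw [← map_star, ← map_mul]
    exact key _

end Factors

end

/-! ### The four terminal objects and the isomorphisms -/

theorem mainTheorem11 {H : Type u} [NormedAddCommGroup H] [InnerProductSpace ℂ H]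
    [CompleteSpace H] (N M : VonNeumannAlgebra H) (hN : IsFiniteFactor N) (hM : IsFiniteFactor M)
    (hNM : N ≤ M) (τ : M.toStarSubalgebra →ₗ[ℂ] ℂ) (hτ : IsFaithfulNormalTrace M τ) :
    -- `QGal(N ⊂ M)` and the quantum automorphism group of the algebra object `M` exist
    -- and are isomorphic
    ((∃ Q : GaloisCat (factorInclusion hNM), Nonempty (Limits.IsTerminal Q)) ∧
      (∃ R : QAutCat (factorObj hNM) (factorStar hNM), Nonempty (Limits.IsTerminal R)) ∧
      ∀ (Q : GaloisCat (factorInclusion hNM)) (R : QAutCat (factorObj hNM) (factorStar hNM)),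
        Nonempty (Limits.IsTerminal Q) → Nonempty (Limits.IsTerminal R) →
        ∃ e : Q.hopf ≅ R.hopf, Intertwines e) ∧
    -- likewise for `QGal_τ(N ⊂ M)` and the quantum automorphism group of the algebra object `M`
    -- that preserves the conditional expectation
    (∃ Q : (GaloisCat.preserving (factorInclusion hNM) τ).FullSubcategory,
      Nonempty (Limits.IsTerminal Q)) ∧
    ∀ E : factorObj hNM ⟶ 𝟙_ (NBimod N.toStarSubalgebra), IsTraceExpectation hNM τ E →
      (∃ R : (QAutCat.preserving (factorStar hNM) E).FullSubcategory,
        Nonempty (Limits.IsTerminal R)) ∧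
      ∀ (Q : (GaloisCat.preserving (factorInclusion hNM) τ).FullSubcategory)
        (R : (QAutCat.preserving (factorStar hNM) E).FullSubcategory),
        Nonempty (Limits.IsTerminal Q) → Nonempty (Limits.IsTerminal R) →
        ∃ e : Q.obj.hopf ≅ R.obj.hopf, Intertwines e := by
  -- The unrestricted case is the one with property `⊤`, so both halves use the same transfer
  -- lemmas.
  have htop : ∀ R : QAutCat (factorObj hNM) (factorStar hNM),
      (⊤ : ObjectProperty (QAutCat (factorObj hNM) (factorStar hNM))) R ↔
        (⊤ : ObjectProperty (GaloisCat (factorInclusion hNM))) R.toGalois := fun _ => Iff.rfl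
  have hQ := UnivAlg.isTerminalAmong (⊤ : ObjectProperty (GaloisCat (factorInclusion hNM))) trivial
  have hQτ := UnivAlg.isTerminalAmong (GaloisCat.preserving (factorInclusion hNM) τ)
    (UnivAlg.preservesFunctional_obj _ τ fun _ h => h)
  refine ⟨⟨⟨_, IsTerminalAmong.iff_isTerminal_top.1 hQ⟩,
    ⟨_, IsTerminalAmong.iff_isTerminal_top.1 (GaloisCat.isTerminalAmong_toQAut htop hQ)⟩,
    fun Q R hQ hR => ?_⟩, ⟨⟨_, hQτ.1⟩, IsTerminalAmong.iff_isTerminal.1 hQτ⟩, fun E hE => ?_⟩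
  · obtain ⟨e, he⟩ := IsTerminalAmong.exists_iso htop
      (IsTerminalAmong.iff_isTerminal_top.2 hQ) (IsTerminalAmong.iff_isTerminal_top.2 hR)
    exact ⟨e, fun h x => congrArg (fun f => NBimod.lin f (NBimod.toBimod _ x)) (he h)⟩
  · have hiff := preserving_iff hτ hE
    have hR := GaloisCat.isTerminalAmong_toQAut hiff hQτ
    refine ⟨⟨⟨_, hR.1⟩, IsTerminalAmong.iff_isTerminal.1 hR⟩, fun Q R hQ hR => ?_⟩
    obtain ⟨e, he⟩ := IsTerminalAmong.exists_iso hiff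
      (IsTerminalAmong.iff_isTerminal.2 hQ) (IsTerminalAmong.iff_isTerminal.2 hR)
    exact ⟨e, fun h x => congrArg (fun f => NBimod.lin f (NBimod.toBimod _ x)) (he h)⟩
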